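/- Let $G$ be a (simple) graph on the vertex set $[n]$. Two edges $a_1a_2$, $b_1b_2$ (written with $a_1<a_2$, $b_1<b_2$) cross if $a_1<b_1<a_2<b_2$ or $b_1<a_1<b_2<a_2$. A bond of $G$ is a spanning subgraph all of whose connected components are induced subgraphs of $G$. It is noncrossing if the partition of $[n]$ into its components is noncrossing, i.e. there are no two distinct blocks $B,B'$ and $a,c\in B$, $b,d\in B'$ with $a<b<c<d$. Let $NC_G$ be the poset of noncrossing bonds of $G$ ordered by inclusion; its minimum $\hat 0$ is the graph without edges. The bond of $G$ induced on a set $S\subseteq E(G)$ is the smallest bond of $G$ containing $S$. Let $cc(X)$ denote the number of connected components of $X$. Let $\unlhd$ be a total order on $E(G)$. For a subgraph $X$ of $G$, a broken circuit of $X$ is the edge set of a cycle of $X$ with its $\unlhd$-smallest edge removed. A noncrossing NBC set of $X$ is a subset of $E(X)$ that contains no broken circuit of $X$ and no two crossing edges; it is spanning if the bond of $X$ induced on it is $X$. Let $\mathrm{ncnbc}_k(X)$ be the number of noncrossing NBC sets of $X$ with $k$ elements. The minimum labeling of $NC_G$ labels each cover relation $H\lessdot H'$ by $\lambda(H\lessdot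 H')=\min_{\unlhd}(E(H')\setminus E(H))$. A saturated chain is increasing (resp. decreasing) if its labels, read upwards, strictly increase (resp. weakly decrease). An edge labeling is an EL-labeling if every interval has a unique increasing maximal chain and the label sequence of this chain lexicographically precedes that of every other maximal chain of the interval. Suppose that $NC_G$ has a maximum element $\hat 1$, and that for all $H<H'$ in $NC_G$, with $e=\min_{\unlhd}(E(H')\setminus E(H))$, the bond of $G$ induced on $E(H)\cup\{e\}$ is noncrossing. Then: (a) $NC_G$ is graded (all maximal chains have the same length), with rank function $\rho(X)=n-cc(X)$. (b) The minimum labeling is an EL-labeling of $NC_G$, and $NC_G$ is shellable, i.e. its order complex is shellable. (c) For every $X\in NC_G$, the labels along any decreasing saturated chain from $\hat 0$ to $X$ form a spanning noncrossing NBC set of $X$. (d) For every $X\in NC_G$ and every spanning noncrossing NBC set $S$ of $X$, there is exactly one decreasing saturated chain from $\hat 0$ to $X$ whose set of labels is $S$. (e) Let $\mu(H)=\mu(\hat 0,H)$ be the Möbius function of $NC_G$, let $\rho(NC_G)=\rho(\hat 1)$, and let $\chi(NC_G,t)=\sum_{H\in NC_G}\mu(H)\,t^{\rho(NC_G)-\rho(H)}$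 be its characteristic polynomial. Then for all $H\in NC_G$ $$\mu(H)=(-1)^{n-cc(H)}\,\mathrm{ncnbc}_{n-cc(H)}(H),$$ and $$\chi(NC_G,t)=\sum_{k\ge 0}(-1)^k\,\mathrm{ncnbc}_k(G)\,t^{\rho(NC_G)-k},$$ where $\mathrm{ncnbc}_k(G)=0$ for $k>\rho(NC_G)$. -/

import Mathlib

noncomputable section

namespace NoncrossingBond

/-! ### Finite posets: saturated chains, edge labelings, rank, Möbius function, shellability -/

section Poset

variable {P : Type*} [PartialOrder P]

/-- Saturated chains `x = x₀ ⋖ x₁ ⋖ ⋯ ⋖ x_k = y`.  In a finite poset these are exactly the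
maximal chains of the interval `[x, y]`. -/
inductive SatChain {P : Type*} [PartialOrder P] : P → P → Type _
  | nil (x : P) : SatChain x x
  | cons {x y z : P} (h : x ⋖ y) (c : SatChain y z) : SatChain x z

/-- An edge labeling of `P`: a function from the edges of the Hasse diagram of `P`
(the pairs `x ⋖ y`) to a set of labels `L`. -/
abbrev EdgeLabeling (P : Type*) [PartialOrder P] (L : Type*) : Type _ :=
  {p : P × P // p.1 ⋖ p.2} → L

variable {L : Type*} [PartialOrder L]

/-- The sequence of labels along a saturated chain, read from bottom to top. -/
def SatChain.labels {L : Type*} (lam : EdgeLabeling P L) : {x y : P} → SatChain x y → List L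
  | _, _, .nil _ => []
  | _, _, .cons (x := x) (y := y) h c => lam ⟨(x, y), h⟩ :: SatChain.labels lam c

/-- The labels strictly increase along the chain. -/
def SatChain.IsIncreasing (lam : EdgeLabeling P L) {x y : P} (c : SatChain x y) : Prop :=
  (c.labels lam).IsChain (· < ·)

/-- The labels weakly decrease along the chain. -/
def SatChain.IsDecreasing (lam : EdgeLabeling P L) {x y : P} (c : SatChain x y) : Prop :=
  (c.labels lam).IsChain (· ≥ ·)

/-- `lam` is an EL-labeling: every interval `[x, y]` has a unique increasing maximal chain, and
the label sequence of this chain strictly precedes the label sequence of every other maximal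
chain of the interval in the lexicographic order. -/
def IsELLabeling (lam : EdgeLabeling P L) : Prop :=
  ∀ x y : P, x ≤ y → ∃ c : SatChain x y, c.IsIncreasing lam ∧
    (∀ c' : SatChain x y, c'.IsIncreasing lam → c' = c) ∧
    ∀ c' : SatChain x y, c' ≠ c → List.Lex (· < ·) (c.labels lam) (c'.labels lam)

/-- A finite poset is graded if all its maximal chains have the same length. -/
def IsGraded (P : Type*) [PartialOrder P] : Prop :=
  ∀ F F' : Flag P, (F : Set P).ncard = (F' : Set P).ncard

/-- The rank `ρ(x)` of an element of a finite poset: the largest length of a chain with top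
element `x`. In a graded poset this is the usual rank function. -/
def rank (x : P) : ℕ := (Order.height x).toNat

/-- The rank `ρ(P)` of a finite poset: the largest rank of an element. -/
def posetRank (P : Type*) [PartialOrder P] [Finite P] : ℕ :=
  letI := Fintype.ofFinite P
  Finset.univ.sup (rank : P → ℕ)

/-- The one-variable Möbius function `μ(x) = μ(0̂, x)` of a finite poset with `0̂`. -/
def mobius [OrderBot P] [Finite P] (x : P) : ℤ :=
  letI := Fintype.ofFinite P
  letI : DecidableEq P := Classical.decEq P
  letI : DecidableLE P := Classical.decRel _
  letI : DecidableLT P := Classical.decRel _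
  letI : LocallyFiniteOrder P := Fintype.toLocallyFiniteOrder
  IncidenceAlgebra.mu ℤ (⊥ : P) x

open Classical in
/-- The recursion that determines the Möbius function. -/
theorem mobius_eq [OrderBot P] [Fintype P] (x : P) :
    mobius x = if x = ⊥ then 1 else -∑ y ∈ Finset.univ.filter (· < x), mobius y := by
  let _ : LocallyFiniteOrder P := Fintype.toLocallyFiniteOrder
  have key : ∀ y : P, mobius y = IncidenceAlgebra.mu ℤ (⊥ : P) y := fun y => by
    unfold mobius
    convert rfl
  simp only [key]
  rw [IncidenceAlgebra.mu_apply]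
  by_cases hx : x = ⊥
  · simp [hx]
  · rw [if_neg (Ne.symm hx), if_neg hx]
    congr 1
    refine Finset.sum_congr ?_ fun _ _ => rfl
    ext y
    simp

/-- The characteristic polynomial `χ(P, t) = ∑_{x ∈ P} μ(x) t^{ρ(P) - ρ(x)}`. -/
def charPoly (P : Type*) [PartialOrder P] [OrderBot P] [Finite P] : Polynomial ℤ :=
  letI := Fintype.ofFinite P
  ∑ x : P, Polynomial.C (mobius x) * Polynomial.X ^ (posetRank P - rank x)

/-- The order complex of `P`: its faces are the finite chains of `P` (the empty one included). -/
def orderComplex (P : Type*) [PartialOrder P] : Set (Finset P) :=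
  {s | IsChain (· ≤ ·) (s : Set P)}

/-- A finite simplicial complex `Δ` (given by its set of faces) is shellable if its facets can be
ordered `F₀, F₁, …, F_{t-1}` so that for every `j ≥ 1` the complex
`⟨F_j⟩ ∩ (⟨F₀⟩ ∪ ⋯ ∪ ⟨F_{j-1}⟩)` is pure of dimension `dim F_j - 1`, i.e. all its
inclusion-maximal faces have one element less than `F_j`. -/
def IsShellable {V : Type*} (Δ : Set (Finset V)) : Prop :=
  ∃ (t : ℕ) (F : Fin t → Finset V), Function.Injective F ∧
    (∀ s, (∃ j, F j = s) ↔ Maximal (· ∈ Δ) s) ∧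
    ∀ (j : Fin t) (s : Finset V),
      Maximal (fun s => s ⊆ F j ∧ ∃ i, i < j ∧ s ⊆ F i) s → s.card + 1 = (F j).card

end Poset

/-! ### Noncrossing bonds

A spanning subgraph of a graph `G` on the vertex set `Fin n` is a graph `H ≤ G` on `Fin n`. -/

section Graph

variable {n : ℕ}

/-- Two edges cross in the drawing with the vertices placed in order around a circle. -/
def EdgesCross (e f : Sym2 (Fin n)) : Prop :=
  ∃ a b c d : Fin n, a < b ∧ b < c ∧ c < d ∧
    ((e = s(a, c) ∧ f = s(b, d)) ∨ (e = s(b, d) ∧ f = s(a, c)))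

/-- `H` is a bond of `G`: a spanning subgraph all of whose connected components are induced. -/
def IsBond (G H : SimpleGraph (Fin n)) : Prop :=
  H ≤ G ∧ ∀ u v, H.Reachable u v → G.Adj u v → H.Adj u v

/-- The partition of the vertices into the connected components of `H` is noncrossing: there are
no two distinct blocks `B ≠ B'` and `a, c ∈ B`, `b, d ∈ B'` with `a < b < c < d`. -/
def IsNoncrossing (H : SimpleGraph (Fin n)) : Prop :=
  ¬ ∃ B B' : H.ConnectedComponent, B ≠ B' ∧ ∃ a b c d : Fin n, a < b ∧ b < c ∧ c < d ∧
    a ∈ B.supp ∧ c ∈ B.supp ∧ b ∈ B'.supp ∧ d ∈ B'.supp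

/-- The noncrossing bond poset of `G`: the noncrossing bonds of `G`, ordered by inclusion. -/
abbrev NC (G : SimpleGraph (Fin n)) : Type :=
  {H : SimpleGraph (Fin n) // IsBond G H ∧ IsNoncrossing H}

theorem isBond_bot (G : SimpleGraph (Fin n)) : IsBond G ⊥ :=
  ⟨bot_le, fun u v h hG => by
    rw [SimpleGraph.reachable_bot] at h
    exact absurd h hG.ne⟩

theorem isNoncrossing_bot : IsNoncrossing (⊥ : SimpleGraph (Fin n)) := by
  rintro ⟨B, B', -, a, b, c, d, hab, hbc, -, ha, hc, -, -⟩
  have h := SimpleGraph.ConnectedComponent.exact (ha.trans hc.symm)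
  rw [SimpleGraph.reachable_bot] at h
  exact (hab.trans hbc).ne h

/-- The minimum `0̂` of the noncrossing bond poset is the graph without edges. -/
instance (G : SimpleGraph (Fin n)) : OrderBot (NC G) where
  bot := ⟨⊥, isBond_bot G, isNoncrossing_bot⟩
  bot_le _ := bot_le (α := SimpleGraph (Fin n))

/-- The number of connected components. -/
def cc (H : SimpleGraph (Fin n)) : ℕ := Nat.card H.ConnectedComponent

/-- The bond of `G` induced on a set of edges `S ⊆ E(G)`: the connected components of the spanning
subgraph with edge set `S`, with all edges of `G` inside them. It is the smallest bond
of `G` that contains `S`. -/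
def inducedBond (G : SimpleGraph (Fin n)) (S : Set (Sym2 (Fin n))) : SimpleGraph (Fin n) where
  Adj u v := G.Adj u v ∧ (SimpleGraph.fromEdgeSet S).Reachable u v
  symm := ⟨fun _ _ h => ⟨h.1.symm, h.2.symm⟩⟩
  loopless := ⟨fun _ h => h.1.ne rfl⟩

/-- The type of edges of `G`. (It is a structure of its own, and not a subtype of `Sym2 (Fin n)`, so
that it carries no order besides the total order of `E(G)` that is chosen below.) -/
@[ext]
structure Edge (G : SimpleGraph (Fin n)) : Type where
  /-- The underlying unordered pair. -/
  val : Sym2 (Fin n)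
  mem : val ∈ G.edgeSet

instance (G : SimpleGraph (Fin n)) : Finite (Edge G) :=
  Finite.of_injective Edge.val fun _ _ h => Edge.ext h

variable {G : SimpleGraph (Fin n)}

open Classical in
/-- The set `E(H') \ E(H)`, as a set of edges of `G`. -/
def edgeDiff (H H' : NC G) : Finset (Edge G) :=
  letI := Fintype.ofFinite (Edge G)
  Finset.univ.filter fun e => e.val ∈ H'.1.edgeSet \ H.1.edgeSet

theorem edgeDiff_nonempty {H H' : NC G} (h : H < H') : (edgeDiff H H').Nonempty := by
  have h2 : ¬ H'.1.edgeSet ⊆ H.1.edgeSet := by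
    rw [SimpleGraph.edgeSet_subset_edgeSet]
    exact fun h' => h.not_ge h'
  obtain ⟨e, he, he'⟩ := Set.not_subset.1 h2
  exact ⟨⟨e, SimpleGraph.edgeSet_mono H'.2.1.1 he⟩, by simp [edgeDiff, he, he']⟩

/-- `min (E(H') \ E(H))` for `H < H'`, with respect to the given total order of `E(G)`. -/
def minEdge [LinearOrder (Edge G)] {H H' : NC G} (h : H < H') : Edge G :=
  (edgeDiff H H').min' (edgeDiff_nonempty h)

/-- The minimum labeling `λ(H ⋖ H') = min (E(H') \ E(H))`. -/
def minLabeling (G : SimpleGraph (Fin n)) [LinearOrder (Edge G)] :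
    EdgeLabeling (NC G) (Edge G) :=
  fun p => minEdge p.2.lt

/-- `B` is a broken circuit of the subgraph `X` of `G`, with respect to the order of `E(G)`: it is
obtained by removing the smallest edge of a cycle of `X`. -/
def IsBrokenCircuit [LinearOrder (Edge G)] (X : SimpleGraph (Fin n)) (B : Set (Edge G)) : Prop :=
  ∃ (v : Fin n) (w : X.Walk v v), w.IsCycle ∧ ∃ e : Edge G,
    IsLeast {f : Edge G | f.val ∈ w.edges} e ∧
    B = {f : Edge G | f.val ∈ w.edges} \ {e}

/-- `S` is a noncrossing NBC set of the subgraph `X` of `G`: a set of edges of `X` that contains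
no broken circuit of `X` and no two edges that cross. -/
def IsNCNBC [LinearOrder (Edge G)] (X : SimpleGraph (Fin n)) (S : Finset (Edge G)) : Prop :=
  (∀ e ∈ S, e.val ∈ X.edgeSet) ∧
  (∀ B : Set (Edge G), B ⊆ (S : Set (Edge G)) → ¬ IsBrokenCircuit X B) ∧
  ∀ e ∈ S, ∀ f ∈ S, ¬ EdgesCross e.val f.val

/-- A noncrossing NBC set `S` of `X` is spanning if the bond of `X` induced on `S` is `X`. -/
def IsSpanningNCNBC [LinearOrder (Edge G)] (X : SimpleGraph (Fin n)) (S : Finset (Edge G)) :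
    Prop :=
  IsNCNBC X S ∧ inducedBond X (Edge.val '' (S : Set (Edge G))) = X

/-- The number of noncrossing NBC sets of size `k` of the subgraph `X` of `G`. -/
def ncnbc (G : SimpleGraph (Fin n)) [LinearOrder (Edge G)] (X : SimpleGraph (Fin n)) (k : ℕ) : ℕ :=
  {S : Finset (Edge G) | IsNCNBC X S ∧ S.card = k}.ncard

end Graph

end NoncrossingBond

end

noncomputable section

namespace NoncrossingBond

/-! ### Saturated chains in finite posets -/

section SatChainLemmas

variable {P : Type*} [PartialOrder P]

namespace SatChain

/-! Everything rests on one consequence of the hypothesis: a cover `H ⋖ K` with label `e` is always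
the bond induced on `E(H) ∪ {e}` (`MinEdgeClosed.eq_insert_of_covBy`), because that bond is
noncrossing, lies strictly above `H` and is contained in `K`. Hence a cover merges exactly two
components, `n - cc` rises by one, and above a given element the label determines the cover.

The minimum of `E(y) \ E(x)` occurs as a label on every saturated chain from `x` to `y`. An
increasing chain must therefore start with it, which gives the EL property by induction.
Shellability comes from an exchange argument (`isShellable_of_exchange`): maximal chains are ordered
lexicographically by their labels, and a chain that leaves an earlier one has a strict descent,
where replacing one element makes it lexicographically smaller.

A decreasing chain from `0̂` lists a spanning noncrossing NBC set from its largest edge to its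
smallest. No broken circuit appears among the labels because bonds complete cycles
(`cycle_subset_of_labels`). No crossing appears because the least edge of a noncrossing bond crosses
no other edge of it (`MinEdgeClosed.not_edgesCross`). Conversely, a chain for a given set is built
by removing its least edge (`exists_isDecreasing_of_isNCNBC`).

Chain lengths then show that all spanning sets of `X` have `n - cc X` elements. Toggling the least
edge of `X ≠ 0̂` is a sign-reversing involution on the noncrossing NBC sets of `X`. Sorting these
sets by induced bond turns the vanishing signed sum into the recursion for `μ`; sorting the sets of
`G` by size gives `χ`. -/

theorem le {x y : P} (c : SatChain x y) : x ≤ y := by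
  induction c with
  | nil x => exact le_rfl
  | cons h c ih => exact h.le.trans ih

/-- The number of steps of a saturated chain. -/
def length : {x y : P} → SatChain x y → ℕ
  | _, _, .nil _ => 0
  | _, _, .cons _ c => length c + 1

/-- The elements of a saturated chain, from bottom to top. -/
def support : {x y : P} → SatChain x y → List P
  | _, _, .nil x => [x]
  | _, _, .cons (x := x) _ c => x :: support c

/-- Concatenation of saturated chains. -/
def append : {x y z : P} → SatChain x y → SatChain y z → SatChain x z
  | _, _, _, .nil _, d => d
  | _, _, _, .cons h c, d => .cons h (append c d)

theorem labels_append {L : Type*} (lam : EdgeLabeling P L) {x y z : P} (c : SatChain x y)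
    (d : SatChain y z) : (c.append d).labels lam = c.labels lam ++ d.labels lam := by
  induction c with
  | nil x => rfl
  | cons h c ih => simp [append, labels, ih]

theorem length_labels {L : Type*} (lam : EdgeLabeling P L) {x y : P} (c : SatChain x y) :
    (c.labels lam).length = c.length := by
  induction c with
  | nil x => rfl
  | cons h c ih => simp [length, labels, ih]

theorem length_support {x y : P} (c : SatChain x y) : c.support.length = c.length + 1 := by
  induction c with
  | nil x => rfl
  | cons h c ih => simp [length, support, ih]

theorem left_mem_support {x y : P} (c : SatChain x y) : x ∈ c.support := by
  cases c <;> simp [support]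

theorem mem_support_append_right {x y z v : P} (c : SatChain x y) {d : SatChain y z}
    (hv : v ∈ d.support) : v ∈ (c.append d).support := by
  induction c with
  | nil x => exact hv
  | cons h c ih => exact List.mem_cons_of_mem _ (ih hv)

theorem mem_Icc_of_mem_support {x y v : P} (c : SatChain x y) (hv : v ∈ c.support) :
    v ∈ Set.Icc x y := by
  induction c with
  | nil x => simpa [support] using hv
  | cons h c ih =>
    rcases List.mem_cons.1 hv with rfl | hv
    · exact ⟨le_rfl, h.le.trans c.le⟩
    · exact ⟨h.le.trans (ih hv).1, (ih hv).2⟩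

theorem pairwise_support {x y : P} (c : SatChain x y) : c.support.Pairwise (· < ·) := by
  induction c with
  | nil x => simp [support]
  | cons h c ih =>
    exact List.pairwise_cons.2
      ⟨fun v hv => h.lt.trans_le (c.mem_Icc_of_mem_support hv).1, ih⟩

theorem nodup_support {x y : P} (c : SatChain x y) : c.support.Nodup :=
  c.pairwise_support.imp fun h => h.ne

theorem isChain_support {x y : P} (c : SatChain x y) :
    IsChain (· ≤ ·) {v | v ∈ c.support} := by
  induction c with
  | nil x => simp [support, IsChain, Set.pairwise_singleton]
  | @cons x z y h c ih =>
    have : {v | v ∈ (cons h c).support} = insert x {v | v ∈ c.support} :=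
      Set.ext fun v => by simp [support]
    rw [this]
    exact ih.insert fun v hv _ => Or.inl (h.le.trans (c.mem_Icc_of_mem_support hv).1)

/-- A saturated chain is determined by its set of elements. -/
theorem ext_support {x y : P} (c c' : SatChain x y)
    (h : ∀ v, v ∈ c.support ↔ v ∈ c'.support) : c = c' := by
  induction c with
  | nil x =>
    cases c' with
    | nil => rfl
    | cons h' d => exact absurd (h'.lt.trans_le d.le) (lt_irrefl _)
  | @cons x z y hz d ih =>
    cases c' with
    | nil => exact absurd (hz.lt.trans_le d.le) (lt_irrefl _)
    | @cons _ z' _ hz' d' =>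
      have h1 : z' ≤ z := by
        have := (h z).1 (List.mem_cons_of_mem _ d.left_mem_support)
        rcases List.mem_cons.1 this with e | h2
        · exact absurd e hz.lt.ne'
        · exact (d'.mem_Icc_of_mem_support h2).1
      obtain rfl : z' = z := (hz.eq_or_eq hz'.le h1).resolve_left hz'.lt.ne'
      congr 1
      refine ih d' fun v => ?_
      have key := h v
      simp only [support, List.mem_cons] at key
      constructor
      · intro hv
        exact (key.1 (Or.inr hv)).resolve_left
          (hz.lt.trans_le (d.mem_Icc_of_mem_support hv).1).ne'
      · intro hv
        exact (key.2 (Or.inr hv)).resolve_left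
          (hz.lt.trans_le (d'.mem_Icc_of_mem_support hv).1).ne'

/-- A saturated chain is determined by its labels if labels determine covers. -/
theorem ext_labels {L : Type*} {lam : EdgeLabeling P L}
    (hlam : ∀ {x y z : P} (h : x ⋖ y) (h' : x ⋖ z), lam ⟨(x, y), h⟩ = lam ⟨(x, z), h'⟩ → y = z)
    {x y : P} (c c' : SatChain x y) (h : c.labels lam = c'.labels lam) : c = c' := by
  induction c with
  | nil x =>
    cases c' with
    | nil => rfl
    | cons h' d => simp [labels] at h
  | @cons x z y hz d ih =>
    cases c' with
    | nil => simp [labels] at h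
    | @cons _ z' _ hz' d' =>
      simp only [labels, List.cons.injEq] at h
      obtain rfl := hlam hz hz' h.1
      rw [ih d' h.2]

theorem add_length {r : P → ℕ} (hr : ∀ x y, x ⋖ y → r y = r x + 1) {x y : P}
    (c : SatChain x y) : r x + c.length = r y := by
  induction c with
  | nil x => rfl
  | cons h c ih => rw [← ih, hr _ _ h, length]; ring

/-- A chain in an interval of a finite poset extends to a saturated chain. -/
theorem exists_superset [Finite P] {x y : P} (hxy : x ≤ y) (s : Set P)
    (hs : IsChain (· ≤ ·) s) (hsub : s ⊆ Set.Icc x y) :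
    ∃ c : SatChain x y, ∀ v ∈ s, v ∈ c.support := by
  induction x using (Finite.to_wellFoundedGT (α := P)).wf.induction generalizing s with
  | _ x ih =>
  rcases hxy.eq_or_lt with rfl | hlt
  · exact ⟨.nil x, fun v hv => by simpa [support] using hsub hv⟩
  -- `m` is the least element of `s` other than `x`, or `y` if there is none; a cover of `x` below
  -- `m` can serve as the next element.
  · have hm : ∃ m, x < m ∧ m ≤ y ∧ ∀ v ∈ s, v ≠ x → m ≤ v := by
      by_cases hne : (s \ {x}).Nonempty
      · obtain ⟨m, hm⟩ := (Set.toFinite (s \ {x})).exists_minimal hne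
        refine ⟨m, lt_of_le_of_ne (hsub hm.1.1).1 (Ne.symm hm.1.2), (hsub hm.1.1).2,
          fun v hv hvx => ?_⟩
        rcases hs.total hm.1.1 hv with h | h
        · exact h
        · exact hm.2 ⟨hv, hvx⟩ h
      · refine ⟨y, hlt, le_rfl, fun v hv hvx => absurd ⟨v, hv, hvx⟩ hne⟩
    obtain ⟨m, hxm, hmy, hm⟩ := hm
    obtain ⟨z, hz, hzm⟩ := exists_covBy_le_of_lt hxm
    obtain ⟨c, hc⟩ := ih z hz.lt (hzm.trans hmy) (s \ {x}) (hs.mono Set.sdiff_subset)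
      fun v hv => ⟨hzm.trans (hm v hv.1 hv.2), (hsub hv.1).2⟩
    refine ⟨.cons hz c, fun v hv => ?_⟩
    by_cases hvx : v = x
    · simp [support, hvx]
    · exact List.mem_cons_of_mem _ (hc v ⟨hv, hvx⟩)

theorem nonempty [Finite P] {x y : P} (hxy : x ≤ y) : Nonempty (SatChain x y) :=
  (exists_superset hxy ∅ IsChain.empty (Set.empty_subset _)).nonempty

/-- In a finite graded poset, a chain containing a saturated chain from bottom to top consists
of the elements of that chain. -/
theorem mem_support_of_isChain [Finite P] {r : P → ℕ} (hr : ∀ x y, x ⋖ y → r y = r x + 1)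
    {b t : P} (c : SatChain b t) {s : Set P} (hs : IsChain (· ≤ ·) s) (hsub : s ⊆ Set.Icc b t)
    (hc : ∀ v ∈ c.support, v ∈ s) {v : P} (hv : v ∈ s) : v ∈ c.support := by
  -- The saturated chain `d` through `s` has the same ends as `c`, hence the same length, so
  -- containing `c` forces the same elements.
  obtain ⟨d, hd⟩ := exists_superset c.le s hs hsub
  have h1 : c.support.Subperm d.support :=
    c.nodup_support.subperm fun v hv => hd v (hc v hv)
  have h2 : d.support.length ≤ c.support.length := by
    have e1 := c.add_length hr
    have e2 := d.add_length hr
    rw [length_support, length_support]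
    omega
  exact (h1.perm_of_length_le h2).mem_iff.2 (hd v hv)

end SatChain

/-! ### Gradedness and rank -/

/-- A flag extends to a saturated chain from `b` to `t` and equals it by maximality; `r` fixes the
length of that chain. -/
theorem isGraded_of_covBy [Finite P] {r : P → ℕ} (hr : ∀ x y, x ⋖ y → r y = r x + 1)
    {b t : P} (hb : IsBot b) (ht : IsTop t) : IsGraded P := by
  classical
  have key : ∀ F : Flag P, (F : Set P).ncard = r t - r b + 1 := by
    intro F
    obtain ⟨c, hc⟩ := SatChain.exists_superset (hb t) (F : Set P) F.chain_le
      fun v _ => ⟨hb v, ht v⟩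
    have hF : (F : Set P) = c.support.toFinset := by
      have := F.max_chain' (s := {v | v ∈ c.support}) c.isChain_support hc
      exact this.trans (Set.ext fun v => by simp)
    rw [hF, Set.ncard_coe_finset, List.toFinset_card_of_nodup c.nodup_support, c.length_support]
    have := c.add_length hr
    omega
  intro F F'
  rw [key, key]

/-- A strictly monotone function bounds the height from above, and a saturated chain from `b`
attains the bound. -/
theorem rank_eq_of_covBy [Finite P] {r : P → ℕ} (hr : ∀ x y, x ⋖ y → r y = r x + 1)
    {b : P} (hb : IsBot b) (hrb : r b = 0) (x : P) : rank x = r x := by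
  have hmono : StrictMono r := by
    intro y z hyz
    obtain ⟨w, hw, hwz⟩ := exists_covBy_le_of_lt hyz
    obtain ⟨c⟩ := SatChain.nonempty hwz
    have := c.add_length hr
    have := hr _ _ hw
    omega
  have h1 : Order.height x ≤ r x := by
    simpa using Order.height_le_height_apply_of_strictMono r hmono x
  have h2 : ∀ {y z : P} (c : SatChain y z), Order.height y + c.length ≤ Order.height z := by
    intro y z c
    induction c with
    | nil x => simp [SatChain.length]
    | @cons x y z h c ih =>
      have := Order.height_add_one_le h.lt
      calc Order.height x + ((c.length + 1 : ℕ) : ℕ∞)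
          = (Order.height x + 1) + c.length := by push_cast; ring
        _ ≤ Order.height y + c.length := by gcongr
        _ ≤ _ := ih
  obtain ⟨c⟩ := SatChain.nonempty (hb x)
  have h3 : (r x : ℕ∞) ≤ Order.height x := by
    have e := c.add_length hr
    rw [hrb, zero_add] at e
    rw [← e]
    exact le_trans le_add_self (h2 c)
  rw [rank, le_antisymm h1 h3, ENat.toNat_natCast]

/-! ### Shellability from a lexicographic exchange property -/

open Classical in
-- If `c` precedes `c'`, their common face misses some `v` of `c'`, and `c'` without `v` is still a
-- face of an earlier facet. So every maximal face in the intersection with earlier facets is a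
-- facet with one vertex removed.
theorem isShellable_of_exchange [Finite P] {L : Type*} [LinearOrder L] {lam : EdgeLabeling P L}
    {r : P → ℕ} (hr : ∀ x y, x ⋖ y → r y = r x + 1) {b t : P} (hb : IsBot b) (ht : IsTop t)
    (hlam : ∀ {x y z : P} (h : x ⋖ y) (h' : x ⋖ z), lam ⟨(x, y), h⟩ = lam ⟨(x, z), h'⟩ → y = z)
    (hex : ∀ c c' : SatChain b t, List.Lex (· < ·) (c.labels lam) (c'.labels lam) →
      ∃ v ∈ c'.support, v ∉ c.support ∧ ∃ c'' : SatChain b t,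
        List.Lex (· < ·) (c''.labels lam) (c'.labels lam) ∧
        ∀ u ∈ c'.support, u ≠ v → u ∈ c''.support) :
    IsShellable (orderComplex P) := by
  have hinj : Function.Injective fun c : SatChain b t => c.support.toFinset := by
    intro c c' h
    refine c.ext_support c' fun v => ?_
    rw [← List.mem_toFinset, ← List.mem_toFinset]
    exact iff_of_eq (congrArg (v ∈ ·) h)
  have : Finite (SatChain b t) := Finite.of_injective _ hinj
  let _ := Fintype.ofFinite (SatChain b t)
  have hlinj : Function.Injective fun c : SatChain b t => c.labels lam :=
    fun c c' h => c.ext_labels hlam c' h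
  -- Distinct chains have distinct label sequences, so sorting the sequences lexicographically
  -- enumerates the facets in shelling order.
  let A : Finset (List L) := Finset.univ.image fun c : SatChain b t => c.labels lam
  let f := A.orderIsoOfFin rfl
  have hA : ∀ i, ∃ c : SatChain b t, c.labels lam = (f i : List L) := fun i => by
    obtain ⟨c, -, hc⟩ := Finset.mem_image.1 (f i).2
    exact ⟨c, hc⟩
  choose ch hch using hA
  have hsurj : ∀ c : SatChain b t, ∃ i, ch i = c := fun c => by
    have hc : c.labels lam ∈ A := by simp [A]
    refine ⟨f.symm ⟨_, hc⟩, hlinj ?_⟩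
    simp [hch]
  have hlt : ∀ i j, i < j ↔ List.Lex (· < ·) ((ch i).labels lam) ((ch j).labels lam) := by
    intro i j
    rw [hch, hch]
    exact (f.lt_iff_lt (x := i) (y := j)).symm
  refine ⟨A.card, fun i => (ch i).support.toFinset, ?_, ?_, ?_⟩
  · intro i j h
    have h1 := hinj h
    apply f.injective
    apply Subtype.ext
    rw [← hch, ← hch, h1]
  · intro s
    constructor
    · rintro ⟨i, rfl⟩
      refine ⟨?_, fun u hu hsub => ?_⟩
      · simpa [orderComplex] using (ch i).isChain_support
      · intro v hv
        rw [List.mem_toFinset]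
        exact (ch i).mem_support_of_isChain hr (s := (u : Set P)) hu (fun w _ => ⟨hb w, ht w⟩)
          (fun w hw => hsub (List.mem_toFinset.2 hw)) hv
    · intro hs
      obtain ⟨c, hc⟩ := SatChain.exists_superset (hb t) (s : Set P) hs.1 fun v _ => ⟨hb v, ht v⟩
      obtain ⟨i, rfl⟩ := hsurj c
      refine ⟨i, ?_⟩
      have h1 : s ≤ (ch i).support.toFinset := fun v hv => List.mem_toFinset.2 (hc v hv)
      refine le_antisymm (hs.2 ?_ h1) h1
      simpa [orderComplex] using (ch i).isChain_support
  · rintro j s ⟨⟨hsj, i, hij, hsi⟩, hmax⟩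
    obtain ⟨v, hv, hvi, c'', hlex, hsub⟩ := hex _ _ ((hlt i j).1 hij)
    obtain ⟨k, rfl⟩ := hsurj c''
    have h1 : s ⊆ (ch j).support.toFinset.erase v := fun u hu => by
      refine Finset.mem_erase.2 ⟨?_, hsj hu⟩
      rintro rfl
      exact hvi (List.mem_toFinset.1 (hsi hu))
    -- The facet without `v` is a competitor for `s`, since it lies in the earlier facet of `c''`;
    -- maximality of `s` applies.
    have h2 : (ch j).support.toFinset.erase v ⊆ s :=
      hmax ⟨Finset.erase_subset _ _, k, (hlt k j).2 hlex, fun u hu => by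
        rw [Finset.mem_erase, List.mem_toFinset] at hu
        exact List.mem_toFinset.2 (hsub u hu.2 hu.1)⟩ h1
    rw [h1.antisymm h2]
    exact Finset.card_erase_add_one (List.mem_toFinset.2 hv)

end SatChainLemmas

/-! ### Reachability after adding an edge -/

section Reachability

variable {V : Type*}

theorem reachable_fromEdgeSet_edgeSet_union {H : SimpleGraph V} {p q u v : V}
    (h : (SimpleGraph.fromEdgeSet (H.edgeSet ∪ {s(p, q)})).Reachable u v) :
    H.Reachable u v ∨ (H.Reachable u p ∧ H.Reachable q v) ∨
      (H.Reachable u q ∧ H.Reachable p v) := by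
  rw [SimpleGraph.reachable_iff_reflTransGen] at h
  induction h with
  | refl => exact Or.inl (SimpleGraph.Reachable.refl _)
  | @tail v w _ hvw ih =>
    rw [SimpleGraph.fromEdgeSet_adj] at hvw
    rcases hvw.1 with hvw | hvw
    · have hvw : H.Reachable v w := SimpleGraph.Adj.reachable hvw
      rcases ih with h | ⟨h, h'⟩ | ⟨h, h'⟩
      · exact Or.inl (h.trans hvw)
      · exact Or.inr (Or.inl ⟨h, h'.trans hvw⟩)
      · exact Or.inr (Or.inr ⟨h, h'.trans hvw⟩)
    · rcases Sym2.eq_iff.1 (Set.mem_singleton_iff.1 hvw) with ⟨rfl, rfl⟩ | ⟨rfl, rfl⟩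
      · rcases ih with h | ⟨h, h'⟩ | ⟨h, h'⟩
        · exact Or.inr (Or.inl ⟨h, SimpleGraph.Reachable.refl _⟩)
        · exact Or.inr (Or.inl ⟨h, SimpleGraph.Reachable.refl _⟩)
        · exact Or.inl h
      · rcases ih with h | ⟨h, h'⟩ | ⟨h, h'⟩
        · exact Or.inr (Or.inr ⟨h, SimpleGraph.Reachable.refl _⟩)
        · exact Or.inl h
        · exact Or.inr (Or.inr ⟨h, SimpleGraph.Reachable.refl _⟩)

theorem le_fromEdgeSet_of_subset {H : SimpleGraph V} {S : Set (Sym2 V)} (h : H.edgeSet ⊆ S) :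
    H ≤ SimpleGraph.fromEdgeSet S := by
  conv_lhs => rw [← SimpleGraph.fromEdgeSet_edgeSet H]
  exact SimpleGraph.fromEdgeSet_mono h

theorem fromEdgeSet_le_of_subset {H : SimpleGraph V} {S : Set (Sym2 V)} (h : S ⊆ H.edgeSet) :
    SimpleGraph.fromEdgeSet S ≤ H := by
  conv_rhs => rw [← SimpleGraph.fromEdgeSet_edgeSet H]
  exact SimpleGraph.fromEdgeSet_mono h

/-- If two graphs have the same connectivity except that two components are merged by an edge,
the number of components differs by one. -/
theorem card_connectedComponent_of_merge [Finite V] {H K : SimpleGraph V} (hHK : H ≤ K) {p q : V}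
    (hpq : ¬ H.Reachable p q) (hK : K.Reachable p q)
    (h : ∀ u v, K.Reachable u v → H.Reachable u v ∨ (H.Reachable u p ∧ H.Reachable q v) ∨
      (H.Reachable u q ∧ H.Reachable p v)) :
    Nat.card H.ConnectedComponent = Nat.card K.ConnectedComponent + 1 := by
  classical
  -- Dropping the component of `q` leaves exactly one component of `H` in each component of `K`.
  let φ : {C : H.ConnectedComponent // C ≠ H.connectedComponentMk q} → K.ConnectedComponent :=
    fun C => C.1.map (SimpleGraph.Hom.ofLE hHK)
  have hφ : Function.Bijective φ := by
    constructor
    · rintro ⟨C, hC⟩ ⟨D, hD⟩ hCD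
      induction C using SimpleGraph.ConnectedComponent.ind with | _ u
      induction D using SimpleGraph.ConnectedComponent.ind with | _ v
      have huv : K.Reachable u v := SimpleGraph.ConnectedComponent.exact hCD
      have hu : ¬ H.Reachable u q := fun h => hC (SimpleGraph.ConnectedComponent.sound h)
      have hv : ¬ H.Reachable v q := fun h => hD (SimpleGraph.ConnectedComponent.sound h)
      rcases h u v huv with h | ⟨-, h⟩ | ⟨h, -⟩
      · exact Subtype.ext (SimpleGraph.ConnectedComponent.sound h)
      · exact absurd h.symm hv
      · exact absurd h hu
    · intro C
      induction C using SimpleGraph.ConnectedComponent.ind with | _ u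
      by_cases hu : H.Reachable u q
      · refine ⟨⟨H.connectedComponentMk p, fun e =>
          hpq (SimpleGraph.ConnectedComponent.exact e)⟩, ?_⟩
        exact SimpleGraph.ConnectedComponent.sound (hK.trans (hu.symm.mono hHK))
      · exact ⟨⟨H.connectedComponentMk u, fun e =>
          hu (SimpleGraph.ConnectedComponent.exact e)⟩, rfl⟩
  rw [← Nat.card_congr (Equiv.ofBijective φ hφ),
    ← Nat.card_congr (Equiv.optionSubtypeNe (H.connectedComponentMk q)), Finite.card_option]

/-- The endpoints of an edge of a cycle are connected by the other edges of the cycle. -/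
theorem reachable_of_mem_cycle {X H : SimpleGraph V} {x u v : V} {w : X.Walk x x}
    (hw : w.IsCycle) (huv : s(u, v) ∈ w.edges)
    (h : ∀ f ∈ w.edges, f ≠ s(u, v) → f ∈ H.edgeSet) : H.Reachable u v := by
  have hmem : ∀ f ∈ w.edges, f ∈ (SimpleGraph.fromEdgeSet {f | f ∈ w.edges}).edgeSet := by
    intro f hf
    rw [SimpleGraph.edgeSet_fromEdgeSet]
    exact ⟨hf, X.not_isDiag_of_mem_edgeSet (w.edges_subset_edgeSet hf)⟩
  have h1 := (SimpleGraph.adj_and_reachable_delete_edges_iff_exists_cycle.2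
    ⟨x, w.transfer _ hmem, hw.transfer hmem, by rwa [SimpleGraph.Walk.edges_transfer]⟩).2
  refine h1.mono fun a b hab => ?_
  rw [SimpleGraph.deleteEdges_adj, SimpleGraph.fromEdgeSet_adj] at hab
  exact h _ hab.1.1 hab.2

/-- An edge between vertices that are connected without it lies on a cycle. -/
theorem exists_cycle_of_reachable {X H : SimpleGraph V} {u v : V} (hHX : H ≤ X)
    (hadj : X.Adj u v) (huv : s(u, v) ∉ H.edgeSet) (h : H.Reachable u v) :
    ∃ (x : V) (w : X.Walk x x), w.IsCycle ∧ s(u, v) ∈ w.edges ∧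
      ∀ f ∈ w.edges, f ≠ s(u, v) → f ∈ H.edgeSet := by
  classical
  obtain ⟨p⟩ := h
  let p' : X.Walk u v := (p.toPath : H.Walk u v).mapLe hHX
  have hp' : p'.IsPath := SimpleGraph.Walk.IsPath.mapLe hHX p.toPath.2
  have hpe : ∀ f ∈ p'.edges, f ∈ H.edgeSet := fun f hf => by
    rw [SimpleGraph.Walk.edges_mapLe_eq_edges] at hf
    exact SimpleGraph.Walk.edges_subset_edgeSet _ hf
  refine ⟨v, SimpleGraph.Walk.cons hadj.symm p', ?_, ?_, ?_⟩
  · rw [SimpleGraph.Walk.cons_isCycle_iff]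
    refine ⟨hp', fun hm => huv ?_⟩
    rw [Sym2.eq_swap]
    exact hpe _ hm
  · simp [Sym2.eq_swap]
  · intro f hf hne
    rw [SimpleGraph.Walk.edges_cons, List.mem_cons] at hf
    rcases hf with rfl | hf
    · exact absurd Sym2.eq_swap hne
    · exact hpe f hf

end Reachability

/-! ### Bonds and noncrossing partitions -/

section Bonds

variable {n : ℕ} {G H K X : SimpleGraph (Fin n)}

theorem isNoncrossing_iff : IsNoncrossing H ↔ ∀ a b c d : Fin n, a < b → b < c → c < d →
    H.Reachable a c → H.Reachable b d → H.Reachable a b := by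
  constructor
  · intro h a b c d hab hbc hcd hac hbd
    by_contra hn
    refine h ⟨H.connectedComponentMk a, H.connectedComponentMk b, fun e =>
      hn (SimpleGraph.ConnectedComponent.exact e), a, b, c, d, hab, hbc, hcd, rfl, ?_, rfl, ?_⟩
    · exact SimpleGraph.ConnectedComponent.sound hac.symm
    · exact SimpleGraph.ConnectedComponent.sound hbd.symm
  · rintro h ⟨B, B', hne, a, b, c, d, hab, hbc, hcd, ha, hc, hb, hd⟩
    rw [SimpleGraph.ConnectedComponent.mem_supp_iff] at ha hb hc hd
    refine hne ?_
    rw [← ha, ← hb]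
    exact SimpleGraph.ConnectedComponent.sound (h a b c d hab hbc hcd
      (SimpleGraph.ConnectedComponent.exact (ha.trans hc.symm))
      (SimpleGraph.ConnectedComponent.exact (hb.trans hd.symm)))

theorem isNoncrossing_congr (h : ∀ u v, H.Reachable u v ↔ K.Reachable u v) :
    IsNoncrossing H ↔ IsNoncrossing K := by
  simp only [isNoncrossing_iff, h]

theorem EdgesCross.symm {e f : Sym2 (Fin n)} (h : EdgesCross e f) : EdgesCross f e := by
  obtain ⟨a, b, c, d, hab, hbc, hcd, ⟨h1, h2⟩ | ⟨h1, h2⟩⟩ := h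
  · exact ⟨a, b, c, d, hab, hbc, hcd, Or.inr ⟨h2, h1⟩⟩
  · exact ⟨a, b, c, d, hab, hbc, hcd, Or.inl ⟨h2, h1⟩⟩

theorem exists_boundary_adj {V : Type*} {H : SimpleGraph V} {a c : V} (h : H.Reachable a c)
    (S : Set V) (ha : a ∈ S) (hc : c ∉ S) :
    ∃ p q, H.Adj p q ∧ H.Reachable a p ∧ p ∈ S ∧ q ∉ S := by
  obtain ⟨w⟩ := h
  obtain ⟨d, -, h1, h2⟩ := w.exists_boundary_dart {x | H.Reachable a x ∧ x ∈ S}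
    ⟨SimpleGraph.Reachable.refl _, ha⟩ fun h => hc h.2
  exact ⟨d.fst, d.snd, d.adj, h1.1, h1.2, fun h => h2 ⟨h1.1.trans d.adj.reachable, h⟩⟩

/-- If a component contains an edge `pq` that separates two vertices of another component, then
two edges cross. -/
theorem exists_edgesCross_of_separates {p q u v : Fin n} (hpq : H.Adj p q)
    (huv : H.Reachable u v) (hpu : ¬ H.Reachable p u) (h1 : p < u) (h2 : u < q)
    (h3 : v < p ∨ q < v) : ∃ e ∈ H.edgeSet, ∃ f ∈ H.edgeSet, EdgesCross e f := by
  -- A path from `u` to `v` must leave the open interval `(p, q)` along some edge `xy`. As `y` is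
  -- neither `p` nor `q`, this edge crosses `pq`.
  obtain ⟨x, y, hxy, hux, hx, hy⟩ := exists_boundary_adj huv {x | p < x ∧ x < q} ⟨h1, h2⟩
    (by rintro ⟨h4, h5⟩; rcases h3 with h | h <;> exact absurd h (by order))
  have huy := hux.trans hxy.reachable
  have hyp : y ≠ p := by rintro rfl; exact hpu huy.symm
  have hyq : y ≠ q := by rintro rfl; exact hpu (hpq.reachable.trans huy.symm)
  refine ⟨s(p, q), hpq, s(x, y), hxy, ?_⟩
  by_cases hlt : p < y
  · have : q < y := lt_of_le_of_ne (not_lt.1 fun h => hy ⟨hlt, h⟩) (Ne.symm hyq)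
    exact ⟨p, x, q, y, hx.1, hx.2, this, Or.inl ⟨rfl, rfl⟩⟩
  · exact ⟨y, p, x, q, lt_of_le_of_ne (not_lt.1 hlt) hyp, hx.1, hx.2, Or.inr ⟨rfl, Sym2.eq_swap⟩⟩

/-- If two distinct blocks crossed at `a < b < c < d`, a path from `a` to `c` would enter the
interval `[b, d]` along an edge that separates `b` from `d`, and the block of `b` and `d` would have
to cross this edge. -/
theorem isNoncrossing_of_edges (h : ∀ e ∈ H.edgeSet, ∀ f ∈ H.edgeSet, ¬ EdgesCross e f) :
    IsNoncrossing H := by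
  rw [isNoncrossing_iff]
  intro a b c d hab hbc hcd hac hbd
  by_contra hn
  obtain ⟨p, q, hpq, hap, hp, hq⟩ := exists_boundary_adj hac {x | x < b ∨ d < x} (Or.inl hab)
    (by rintro (h1 | h1) <;> exact absurd h1 (by order))
  have haq := hap.trans hpq.reachable
  have hqb : q ≠ b := by rintro rfl; exact hn haq
  have hqd : q ≠ d := by rintro rfl; exact hn (haq.trans hbd.symm)
  simp only [Set.mem_ofPred_eq, not_or, not_lt] at hq
  have hbq : b < q := lt_of_le_of_ne hq.1 (Ne.symm hqb)
  have hqd : q < d := lt_of_le_of_ne hq.2 hqd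
  rcases hp with hp | hp
  · obtain ⟨e, he, f, hf, hef⟩ := exists_edgesCross_of_separates hpq hbd
      (fun h => hn (hap.trans h)) hp hbq (Or.inr hqd)
    exact h e he f hf hef
  · obtain ⟨e, he, f, hf, hef⟩ := exists_edgesCross_of_separates hpq.symm hbd.symm
      (fun h => hn ((haq.trans h).trans hbd.symm)) hqd hp (Or.inl hbq)
    exact h e he f hf hef

theorem reachable_of_edgesCross (hH : IsNoncrossing H) {p q x y : Fin n} (hpq : H.Adj p q)
    (hxy : H.Adj x y) (h : EdgesCross s(p, q) s(x, y)) : H.Reachable p x := by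
  rw [isNoncrossing_iff] at hH
  obtain ⟨a, b, c, d, hab, hbc, hcd, h⟩ := h
  have key : ∀ {e f : Sym2 (Fin n)}, e = s(a, c) → f = s(b, d) → e ∈ H.edgeSet → f ∈ H.edgeSet →
      ∀ u ∈ e, ∀ v ∈ f, H.Reachable u v := by
    rintro e f rfl rfl he hf u hu v hv
    have hac := SimpleGraph.Adj.reachable he
    have hbd := SimpleGraph.Adj.reachable hf
    have hr := hH a b c d hab hbc hcd hac hbd
    have h1 : H.Reachable u a := by
      rcases Sym2.mem_iff.1 hu with rfl | rfl
      · exact SimpleGraph.Reachable.refl _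
      · exact hac.symm
    have h2 : H.Reachable b v := by
      rcases Sym2.mem_iff.1 hv with rfl | rfl
      · exact SimpleGraph.Reachable.refl _
      · exact hbd
    exact (h1.trans hr).trans h2
  rcases h with ⟨h1, h2⟩ | ⟨h1, h2⟩
  · exact key h1 h2 hpq hxy p (Sym2.mem_mk_left _ _) x (Sym2.mem_mk_left _ _)
  · exact (key h2 h1 hxy hpq x (Sym2.mem_mk_left _ _) p (Sym2.mem_mk_left _ _)).symm

theorem inducedBond_le (G : SimpleGraph (Fin n)) (S : Set (Sym2 (Fin n))) :
    inducedBond G S ≤ G := fun _ _ h => h.1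

theorem subset_edgeSet_inducedBond {S : Set (Sym2 (Fin n))} (hS : S ⊆ G.edgeSet) :
    S ⊆ (inducedBond G S).edgeSet := by
  intro e he
  induction e with | _ u v
  have hadj : G.Adj u v := hS he
  refine ⟨hadj, SimpleGraph.Adj.reachable ?_⟩
  rw [SimpleGraph.fromEdgeSet_adj]
  exact ⟨he, hadj.ne⟩

theorem reachable_inducedBond {S : Set (Sym2 (Fin n))} (hS : S ⊆ G.edgeSet) (u v : Fin n) :
    (inducedBond G S).Reachable u v ↔ (SimpleGraph.fromEdgeSet S).Reachable u v := by
  constructor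
  · intro h
    rw [SimpleGraph.reachable_iff_reflTransGen] at h
    induction h with
    | refl => exact SimpleGraph.Reachable.refl _
    | tail _ h ih => exact ih.trans h.2
  · exact fun h => h.mono (fromEdgeSet_le_of_subset (subset_edgeSet_inducedBond hS))

theorem isBond_inducedBond {S : Set (Sym2 (Fin n))} (hS : S ⊆ G.edgeSet) :
    IsBond G (inducedBond G S) :=
  ⟨inducedBond_le G S, fun u v h hG => ⟨hG, (reachable_inducedBond hS u v).1 h⟩⟩

theorem inducedBond_le_of_subset {S : Set (Sym2 (Fin n))} (hH : IsBond G H)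
    (hS : S ⊆ H.edgeSet) : inducedBond G S ≤ H :=
  fun u v h => hH.2 u v (h.2.mono (fromEdgeSet_le_of_subset hS)) h.1

/-- The bonds of `G` and of a bond `X` of `G` induced on a set of edges of `X` agree. -/
theorem inducedBond_eq_of_isBond {S : Set (Sym2 (Fin n))} (hX : IsBond G X)
    (hS : S ⊆ X.edgeSet) : inducedBond X S = inducedBond G S := by
  ext u v
  refine ⟨fun h => ⟨hX.1 h.1, h.2⟩, fun h => ⟨inducedBond_le_of_subset hX hS h, h.2⟩⟩

theorem isNoncrossing_inducedBond {S : Set (Sym2 (Fin n))} (hS : S ⊆ G.edgeSet)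
    (h : ∀ e ∈ S, ∀ f ∈ S, ¬ EdgesCross e f) : IsNoncrossing (inducedBond G S) := by
  rw [isNoncrossing_congr (reachable_inducedBond hS)]
  refine isNoncrossing_of_edges fun e he f hf => ?_
  rw [SimpleGraph.edgeSet_fromEdgeSet] at he hf
  exact h e he.1 f hf.1

/-- A bond that contains all but one edge of a cycle contains the cycle. -/
theorem IsBond.mem_of_cycle (hH : IsBond G H) (hX : X ≤ G) {x : Fin n} {w : X.Walk x x}
    (hw : w.IsCycle) {e : Sym2 (Fin n)} (he : e ∈ w.edges)
    (h : ∀ f ∈ w.edges, f ≠ e → f ∈ H.edgeSet) : e ∈ H.edgeSet := by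
  induction e with | _ u v
  exact hH.2 u v (reachable_of_mem_cycle hw he h) (hX (w.edges_subset_edgeSet he))

theorem cc_le (H : SimpleGraph (Fin n)) : cc H ≤ n := by
  have := Nat.card_le_card_of_surjective H.connectedComponentMk
    fun C => C.ind fun v => ⟨v, rfl⟩
  simpa [cc] using this

theorem cc_bot : cc (⊥ : SimpleGraph (Fin n)) = n := by
  have : Function.Bijective (⊥ : SimpleGraph (Fin n)).connectedComponentMk :=
    ⟨fun u v h => by
      have := SimpleGraph.ConnectedComponent.exact h
      rwa [SimpleGraph.reachable_bot] at this, fun C => C.ind fun v => ⟨v, rfl⟩⟩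
  have := Nat.card_congr (Equiv.ofBijective _ this)
  simpa [cc] using this.symm

end Bonds

/-! ### The noncrossing bond poset and its minimum labeling -/

section NoncrossingBondPoset

variable {n : ℕ} {G : SimpleGraph (Fin n)}

theorem union_edge_subset (H : NC G) (e : Edge G) : H.1.edgeSet ∪ {e.val} ⊆ G.edgeSet :=
  Set.union_subset (SimpleGraph.edgeSet_mono H.2.1.1) (Set.singleton_subset_iff.2 e.mem)

/-- The merging description of connectivity in the bond induced on `E(H) ∪ {e}`. -/
theorem reachable_insert_edge {H K : NC G} {p q : Fin n} {hG : s(p, q) ∈ G.edgeSet}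
    (hK : K.1 = inducedBond G (H.1.edgeSet ∪ {(⟨s(p, q), hG⟩ : Edge G).val})) (u v : Fin n)
    (h : K.1.Reachable u v) : H.1.Reachable u v ∨ (H.1.Reachable u p ∧ H.1.Reachable q v) ∨
      (H.1.Reachable u q ∧ H.1.Reachable p v) := by
  rw [hK, reachable_inducedBond (union_edge_subset H _)] at h
  exact reachable_fromEdgeSet_edgeSet_union h

theorem lt_of_eq_insert {H K : NC G} {e : Edge G} (he : e.val ∉ H.1.edgeSet)
    (hK : K.1 = inducedBond G (H.1.edgeSet ∪ {e.val})) : H < K := by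
  have hsub := subset_edgeSet_inducedBond (union_edge_subset H e)
  rw [← hK] at hsub
  refine lt_of_le_not_ge
    (SimpleGraph.edgeSet_subset_edgeSet.1 (Set.subset_union_left.trans hsub)) fun h => he ?_
  exact SimpleGraph.edgeSet_mono h (hsub (Or.inr rfl))

/-- A bond `M` with `H < M < K` has an edge outside `H`, which can only join the two components that
`K` merges. Then the ends of `e` are connected in `M`, so `e ∈ M` and `K ≤ M`. -/
theorem covBy_of_eq_insert {H K : NC G} {e : Edge G} (he : e.val ∉ H.1.edgeSet)
    (hK : K.1 = inducedBond G (H.1.edgeSet ∪ {e.val})) : H ⋖ K := by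
  refine ⟨lt_of_eq_insert he hK, fun M hHM hMK => hMK.not_ge ?_⟩
  obtain ⟨⟨p, q⟩, hG⟩ := e
  have h1 : ¬ M.1.edgeSet ⊆ H.1.edgeSet := fun h =>
    hHM.not_ge (SimpleGraph.edgeSet_subset_edgeSet.1 h)
  obtain ⟨⟨u, v⟩, hM, hH⟩ := Set.not_subset.1 h1
  have hMuv : M.1.Adj u v := hM
  have hmono : ∀ {a b}, H.1.Reachable a b → M.1.Reachable a b := fun h => h.mono hHM.le
  have huv := reachable_insert_edge hK u v (SimpleGraph.Adj.reachable (hMK.le hMuv))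
  have hpq : M.1.Reachable p q := by
    rcases huv with h | ⟨h, h'⟩ | ⟨h, h'⟩
    · exact absurd (H.2.1.2 u v h (M.2.1.1 hMuv)) hH
    · exact ((hmono h).symm.trans hMuv.reachable).trans (hmono h').symm
    · exact (hmono h').trans (hMuv.reachable.symm.trans (hmono h))
  have he : s(p, q) ∈ M.1.edgeSet := M.2.1.2 p q hpq hG
  change K.1 ≤ M.1
  rw [hK]
  exact inducedBond_le_of_subset M.2.1 (Set.union_subset (SimpleGraph.edgeSet_mono hHM.le)
    (Set.singleton_subset_iff.2 he))

theorem cc_of_eq_insert {H K : NC G} {e : Edge G} (he : e.val ∉ H.1.edgeSet)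
    (hK : K.1 = inducedBond G (H.1.edgeSet ∪ {e.val})) : cc H.1 = cc K.1 + 1 := by
  have hlt := lt_of_eq_insert he hK
  have hsub := subset_edgeSet_inducedBond (union_edge_subset H e)
  rw [← hK] at hsub
  obtain ⟨⟨p, q⟩, hG⟩ := e
  refine card_connectedComponent_of_merge hlt.le (p := p) (q := q)
    (fun h => he (H.2.1.2 p q h hG)) ?_ (reachable_insert_edge hK)
  have h2 : s(p, q) ∈ K.1.edgeSet := hsub (Or.inr rfl)
  exact SimpleGraph.Adj.reachable h2

/-- The noncrossing bond whose only edge is `e`. -/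
theorem exists_single_edge_bond (e : Edge G) :
    ∃ H : NC G, H.1.edgeSet = {e.val} := by
  obtain ⟨⟨p, q⟩, hG⟩ := e
  have hS : {s(p, q)} ⊆ G.edgeSet := Set.singleton_subset_iff.2 hG
  refine ⟨⟨inducedBond G {s(p, q)}, isBond_inducedBond hS, isNoncrossing_inducedBond hS ?_⟩,
    ?_⟩
  · rintro e rfl f rfl ⟨a, b, c, d, hab, hbc, hcd, ⟨h1, h2⟩ | ⟨h1, h2⟩⟩ <;>
    · rcases Sym2.eq_iff.1 (h1.symm.trans h2) with ⟨h, h'⟩ | ⟨h, h'⟩ <;> order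
  · refine Set.Subset.antisymm ?_ (subset_edgeSet_inducedBond hS)
    rintro ⟨u, v⟩ h
    have huv : (SimpleGraph.fromEdgeSet {s(p, q)}).Reachable u v := h.2
    -- A single edge is an edge added to the empty graph, so the merging description of connectivity
    -- applies.
    have h3 : (SimpleGraph.fromEdgeSet
        ((⊥ : SimpleGraph (Fin n)).edgeSet ∪ {s(p, q)})).Reachable u v := by
      simpa using huv
    have hne : u ≠ v := h.1.ne
    have := reachable_fromEdgeSet_edgeSet_union h3
    simp only [SimpleGraph.reachable_bot] at this
    rcases this with h | ⟨rfl, rfl⟩ | ⟨rfl, rfl⟩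
    · exact absurd h hne
    · rfl
    · exact Sym2.eq_swap

/-- If the noncrossing bond poset has a maximum, then this is the graph `G`. -/
theorem eq_of_isTop {T : NC G} (hT : IsTop T) : T.1 = G := by
  refine le_antisymm T.2.1.1 (SimpleGraph.edgeSet_subset_edgeSet.1 fun e he => ?_)
  obtain ⟨H, hH⟩ := exists_single_edge_bond (⟨e, he⟩ : Edge G)
  exact SimpleGraph.edgeSet_mono (hT H) (hH ▸ rfl)

theorem mem_edgeDiff {H H' : NC G} {e : Edge G} :
    e ∈ edgeDiff H H' ↔ e.val ∈ H'.1.edgeSet ∧ e.val ∉ H.1.edgeSet := by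
  simp [edgeDiff]

variable [LinearOrder (Edge G)]

theorem minEdge_mem {H H' : NC G} (h : H < H') :
    (minEdge h).val ∈ H'.1.edgeSet ∧ (minEdge h).val ∉ H.1.edgeSet :=
  mem_edgeDiff.1 (Finset.min'_mem _ (edgeDiff_nonempty h))

theorem minEdge_le {H H' : NC G} (h : H < H') {f : Edge G} (hf : f.val ∈ H'.1.edgeSet)
    (hf' : f.val ∉ H.1.edgeSet) : minEdge h ≤ f :=
  Finset.min'_le _ _ (mem_edgeDiff.2 ⟨hf, hf'⟩)

theorem label_mem {H K : NC G} (h : H ⋖ K) :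
    (minLabeling G ⟨(H, K), h⟩).val ∈ K.1.edgeSet := (minEdge_mem h.lt).1

theorem label_notMem {H K : NC G} (h : H ⋖ K) :
    (minLabeling G ⟨(H, K), h⟩).val ∉ H.1.edgeSet := (minEdge_mem h.lt).2

theorem label_le {H K : NC G} (h : H ⋖ K) {f : Edge G} (hf : f.val ∈ K.1.edgeSet)
    (hf' : f.val ∉ H.1.edgeSet) : minLabeling G ⟨(H, K), h⟩ ≤ f := minEdge_le h.lt hf hf'

theorem mem_of_mem_labels {x y : NC G} (c : SatChain x y) {e : Edge G}
    (he : e ∈ c.labels (minLabeling G)) : e.val ∈ y.1.edgeSet ∧ e.val ∉ x.1.edgeSet := by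
  induction c with
  | nil x => simp [SatChain.labels] at he
  | cons h c ih =>
    rcases List.mem_cons.1 he with rfl | he
    · exact ⟨SimpleGraph.edgeSet_mono c.le (label_mem h), label_notMem h⟩
    · exact ⟨(ih he).1, fun h' => (ih he).2 (SimpleGraph.edgeSet_mono h.le h')⟩

theorem nodup_labels {x y : NC G} (c : SatChain x y) : (c.labels (minLabeling G)).Nodup := by
  induction c with
  | nil x => simp [SatChain.labels]
  | cons h c ih =>
    exact List.nodup_cons.2 ⟨fun h' => (mem_of_mem_labels c h').2 (label_mem h), ih⟩

/-- The first step that reaches `e` has label `e`: its label is at most `e`, and no edge outside `x`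
is smaller. -/
theorem mem_labels_of_forall_le {x y : NC G} (c : SatChain x y) {e : Edge G}
    (hy : e.val ∈ y.1.edgeSet) (hx : e.val ∉ x.1.edgeSet)
    (hle : ∀ f : Edge G, f.val ∈ y.1.edgeSet → f.val ∉ x.1.edgeSet → e ≤ f) :
    e ∈ c.labels (minLabeling G) := by
  induction c with
  | nil x => exact absurd hy hx
  | @cons x z y h c ih =>
    by_cases hz : e.val ∈ z.1.edgeSet
    · have h1 := label_le h hz hx
      have h2 := hle _ (SimpleGraph.edgeSet_mono c.le (label_mem h)) (label_notMem h)
      exact List.mem_cons.2 (Or.inl (le_antisymm h2 h1))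
    · exact List.mem_cons.2 (Or.inr (ih hy hz fun f hf hf' =>
        hle f hf fun h' => hf' (SimpleGraph.edgeSet_mono h.le h')))

variable (G) in
/-- Adding the smallest missing edge of a larger noncrossing bond yields a noncrossing bond. -/
def MinEdgeClosed : Prop :=
  ∀ (H H' : NC G) (h : H < H'), IsNoncrossing (inducedBond G (H.1.edgeSet ∪ {(minEdge h).val}))


/-- The cover of `H` in `[H, H']` obtained by adding the smallest missing edge. -/
theorem MinEdgeClosed.exists_covBy (hmin : MinEdgeClosed G) {H H' : NC G} (h : H < H') :
    ∃ (K : NC G) (hK : H ⋖ K), K ≤ H' ∧ minLabeling G ⟨(H, K), hK⟩ = minEdge h ∧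
      K.1 = inducedBond G (H.1.edgeSet ∪ {(minEdge h).val}) := by
  have hS := union_edge_subset H (minEdge h)
  let K : NC G := ⟨_, isBond_inducedBond hS, hmin H H' h⟩
  have hK : H ⋖ K := covBy_of_eq_insert (minEdge_mem h).2 rfl
  have hKH' : K ≤ H' := inducedBond_le_of_subset H'.2.1
    (Set.union_subset (SimpleGraph.edgeSet_mono h.le)
      (Set.singleton_subset_iff.2 (minEdge_mem h).1))
  refine ⟨K, hK, hKH', le_antisymm ?_ ?_, rfl⟩
  · exact label_le hK (subset_edgeSet_inducedBond hS (Or.inr rfl)) (minEdge_mem h).2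
  · exact minEdge_le h (SimpleGraph.edgeSet_mono hKH' (label_mem hK)) (label_notMem hK)

/-- Adding the least missing edge gives an element strictly above `H` and at most `K`; a cover
leaves room only for `K`. -/
theorem MinEdgeClosed.eq_insert_of_covBy (hmin : MinEdgeClosed G) {H K : NC G} (h : H ⋖ K) :
    K.1 = inducedBond G (H.1.edgeSet ∪ {(minLabeling G ⟨(H, K), h⟩).val}) := by
  obtain ⟨M, hM, hMK, -, hM'⟩ := hmin.exists_covBy h.lt
  obtain rfl : M = K := (h.eq_or_eq hM.le hMK).resolve_left hM.lt.ne'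
  exact hM'

theorem MinEdgeClosed.label_injective (hmin : MinEdgeClosed G) {x y z : NC G} (h : x ⋖ y)
    (h' : x ⋖ z) (e : minLabeling G ⟨(x, y), h⟩ = minLabeling G ⟨(x, z), h'⟩) : y = z := by
  apply Subtype.ext
  rw [hmin.eq_insert_of_covBy h, hmin.eq_insert_of_covBy h', e]

theorem MinEdgeClosed.rank_covBy (hmin : MinEdgeClosed G) (x y : NC G) (h : x ⋖ y) :
    n - cc y.1 = n - cc x.1 + 1 := by
  have h1 := cc_of_eq_insert (label_notMem h) (hmin.eq_insert_of_covBy h)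
  -- Needed because the subtraction in `n - cc` is truncated.
  have h2 := cc_le x.1
  omega

theorem MinEdgeClosed.rank_eq (hmin : MinEdgeClosed G) (X : NC G) : rank X = n - cc X.1 :=
  rank_eq_of_covBy (r := fun X : NC G => n - cc X.1) hmin.rank_covBy (b := ⊥)
    (fun _ => bot_le) (by change n - cc ⊥ = 0; rw [cc_bot, Nat.sub_self]) X

/-- The minimum of a noncrossing bond crosses no other edge of this bond. -/
theorem MinEdgeClosed.not_edgesCross (hmin : MinEdgeClosed G) {X : NC G} {e f : Edge G}
    (he : e.val ∈ X.1.edgeSet) (hf : f.val ∈ X.1.edgeSet)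
    (hle : ∀ g : Edge G, g.val ∈ X.1.edgeSet → e ≤ g) : ¬ EdgesCross e.val f.val := by
  intro hcross
  obtain ⟨H, hH⟩ := exists_single_edge_bond f
  have hef : e.val ≠ f.val := by
    obtain ⟨a, b, c, d, hab, hbc, hcd, ⟨h1, h2⟩ | ⟨h1, h2⟩⟩ := hcross <;>
    · rw [h1, h2]
      intro h
      rcases Sym2.eq_iff.1 h with ⟨h, h'⟩ | ⟨h, h'⟩ <;> order
  have heH : e.val ∉ H.1.edgeSet := by rw [hH]; exact hef
  have hHX : H < X := by
    refine lt_of_le_not_ge ?_ fun h => heH (SimpleGraph.edgeSet_mono h he)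
    refine SimpleGraph.edgeSet_subset_edgeSet.1 ?_
    rw [hH]
    exact Set.singleton_subset_iff.2 hf
  obtain ⟨K, hK, -, hlab, hK'⟩ := hmin.exists_covBy hHX
  -- Being least in all of `X`, `e` is the edge that the hypothesis adds to the bond with the single
  -- edge `f`.
  obtain rfl : minEdge hHX = e := le_antisymm (minEdge_le hHX he heH)
    (hle _ (minEdge_mem hHX).1)
  obtain ⟨⟨p, q⟩, hpq⟩ := f
  have hHpq : H.1.Adj p q := by
    have : s(p, q) ∈ H.1.edgeSet := by rw [hH]; rfl
    exact this
  generalize hm : minEdge hHX = m at *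
  obtain ⟨⟨u, v⟩, huv⟩ := m
  have hKuv : K.1.Adj u v := by
    have : s(u, v) ∈ K.1.edgeSet := by
      have h1 := label_mem hK
      rwa [hlab] at h1
    exact this
  have hr := reachable_of_edgesCross K.2.2 (hK.le hHpq) hKuv hcross.symm
  have hpx : ∀ x, H.1.Reachable p x → x = p ∨ x = q := by
    intro x hx
    by_cases hxp : x = p
    · exact Or.inl hxp
    · obtain ⟨y, hxy⟩ : ∃ y, H.1.Adj x y := by
        obtain ⟨w⟩ := hx.symm
        cases w with
        | nil => exact absurd rfl hxp
        | cons h _ => exact ⟨_, h⟩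
      have h2 : s(x, y) ∈ H.1.edgeSet := hxy
      rw [hH] at h2
      rcases Sym2.eq_iff.1 (Set.mem_singleton_iff.1 h2) with ⟨h, -⟩ | ⟨h, -⟩
      · exact Or.inl h
      · exact Or.inr h
  obtain ⟨a, b, c, d, hab, hbc, hcd, h⟩ := hcross
  have hdisj : u ≠ p ∧ u ≠ q ∧ v ≠ p ∧ v ≠ q := by
    rcases h with ⟨h1, h2⟩ | ⟨h1, h2⟩ <;>
    · rcases Sym2.eq_iff.1 h1 with ⟨rfl, rfl⟩ | ⟨rfl, rfl⟩ <;>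
      rcases Sym2.eq_iff.1 h2 with ⟨rfl, rfl⟩ | ⟨rfl, rfl⟩ <;>
      refine ⟨?_, ?_, ?_, ?_⟩ <;> order
  -- Noncrossing forces `p` and `u` together in `K`. But `K` only merges the `H`-components of `u`
  -- and `v`, and neither vertex lies in the `H`-component of `p`, which is contained in `{p, q}`.
  rcases reachable_insert_edge hK' p u hr with h | ⟨h, -⟩ | ⟨h, -⟩
  · rcases hpx _ h with h | h
    exacts [hdisj.1 h, hdisj.2.1 h]
  · rcases hpx _ h with h | h
    exacts [hdisj.1 h, hdisj.2.1 h]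
  · rcases hpx _ h with h | h
    exacts [hdisj.2.2.1 h, hdisj.2.2.2 h]

/-! ### EL-labeling and shellability -/

/-- The increasing chain adds the least missing edge each time. Any other first step has a larger
label, which makes the chain lexicographically later and also prevents it from increasing, as the
least edge must still occur. -/
theorem MinEdgeClosed.isELLabeling (hmin : MinEdgeClosed G) : IsELLabeling (minLabeling G) := by
  intro x y hxy
  induction x using (Finite.to_wellFoundedGT (α := NC G)).wf.induction with
  | _ x ih =>
  rcases hxy.eq_or_lt with rfl | hlt
  · have hnil : ∀ c : SatChain x x, c = .nil x := by
      intro c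
      cases c with
      | nil => rfl
      | cons h d => exact absurd (h.lt.trans_le d.le) (lt_irrefl _)
    exact ⟨.nil x, List.IsChain.nil, fun c _ => hnil c, fun c hc => absurd (hnil c) hc⟩
  · obtain ⟨K, hK, hKy, hlab, -⟩ := hmin.exists_covBy hlt
    obtain ⟨c, hc, huniq, hlex⟩ := ih K hK.lt hKy
    refine ⟨.cons hK c, ?_, ?_, ?_⟩
    · refine List.isChain_cons.2 ⟨fun g hg => ?_, hc⟩
      have hg := mem_of_mem_labels c (List.mem_of_mem_head? hg)
      rw [hlab]
      refine lt_of_le_of_ne (minEdge_le hlt hg.1 fun h' =>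
        hg.2 (SimpleGraph.edgeSet_mono hK.le h')) ?_
      rintro rfl
      rw [← hlab] at hg
      exact hg.2 (label_mem hK)
    · intro c' hc'
      have hmem := mem_labels_of_forall_le c' (minEdge_mem hlt).1 (minEdge_mem hlt).2
        fun f hf hf' => minEdge_le hlt hf hf'
      cases c' with
      | nil => exact absurd hlt (lt_irrefl _)
      | @cons _ z _ hz d =>
        have hc'' := List.isChain_cons.1 hc'
        have hle : minEdge hlt ≤ minLabeling G ⟨(x, z), hz⟩ :=
          minEdge_le hlt (SimpleGraph.edgeSet_mono d.le (label_mem hz)) (label_notMem hz)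
        rcases List.mem_cons.1 hmem with h | h
        · obtain rfl : z = K := hmin.label_injective hz hK (h.symm.trans hlab.symm)
          rw [huniq d hc''.2]
        · exact absurd (List.rel_of_pairwise_cons (List.isChain_iff_pairwise.1 hc') h) hle.not_gt
    · intro c' hc'
      cases c' with
      | nil => exact absurd hlt (lt_irrefl _)
      | @cons _ z _ hz d =>
        have hle : minEdge hlt ≤ minLabeling G ⟨(x, z), hz⟩ :=
          minEdge_le hlt (SimpleGraph.edgeSet_mono d.le (label_mem hz)) (label_notMem hz)
        simp only [SatChain.labels]
        rcases hle.eq_or_lt with h | h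
        · obtain rfl : z = K := hmin.label_injective hz hK (h.symm.trans hlab.symm)
          exact List.Lex.cons (hlex d fun e => hc' (by rw [e]))
        · exact List.Lex.rel (hlab.trans_lt h)

/-- A saturated chain whose first label exceeds an edge between its ends has a descent before
this edge is reached, and can be made lexicographically smaller there. -/
theorem MinEdgeClosed.exists_descent (hmin : MinEdgeClosed G) {x z y : NC G} (h : x ⋖ z)
    (d : SatChain z y) {e : Edge G} (hy : e.val ∈ y.1.edgeSet) (hx : e.val ∉ x.1.edgeSet)
    (hlt : e < minLabeling G ⟨(x, z), h⟩) :
    ∃ v ∈ d.support, e.val ∉ v.1.edgeSet ∧ ∃ c : SatChain x y,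
      List.Lex (· < ·) (c.labels (minLabeling G))
        ((SatChain.cons h d).labels (minLabeling G)) ∧
      ∀ u ∈ d.support, u ≠ v → u ∈ c.support := by
  induction d generalizing x with
  | nil y => exact absurd (label_le h hy hx) hlt.not_ge
  | @cons z w y hzw d ih =>
    have hz : e.val ∉ z.1.edgeSet := fun hz => (label_le h hz hx).not_gt hlt
    rcases le_or_gt (minLabeling G ⟨(x, z), h⟩) (minLabeling G ⟨(z, w), hzw⟩) with hle | hgt
    · obtain ⟨v, hv, hev, c, hlex, hsub⟩ := ih hzw hy hz (hlt.trans_le hle)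
      refine ⟨v, List.mem_cons_of_mem _ hv, hev, .cons h c, List.Lex.cons hlex, ?_⟩
      intro u hu huv
      rcases List.mem_cons.1 hu with rfl | hu
      · exact List.mem_cons_of_mem _ c.left_mem_support
      · exact List.mem_cons_of_mem _ (hsub u hu huv)
    · have hxw : x < w := h.lt.trans hzw.lt
      -- The least edge of `E(w) \ E(x)` is at most the label of `z ⋖ w`, hence below that of `x ⋖
      -- z`: replacing `z` lowers the label sequence.
      obtain ⟨K, hK, hKw, hlab, -⟩ := hmin.exists_covBy hxw
      obtain ⟨c⟩ := SatChain.nonempty hKw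
      refine ⟨z, List.mem_cons_self, hz, .cons hK (c.append d), List.Lex.rel ?_, ?_⟩
      · rw [hlab]
        refine lt_of_le_of_lt ?_ hgt
        exact minEdge_le hxw (label_mem hzw) fun h' =>
          label_notMem hzw (SimpleGraph.edgeSet_mono h.le h')
      · intro u hu huz
        exact List.mem_cons_of_mem _ (c.mem_support_append_right
          ((List.mem_cons.1 hu).resolve_left huz))

/-- Where the chains first differ, `c` adds a smaller edge `e`. The chain `c'` has a descent at an
element `v` not containing `e`, while `c` contains `e` from that step on, so `v` is not on `c`. -/
theorem MinEdgeClosed.exists_exchange (hmin : MinEdgeClosed G) {x y : NC G}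
    (c c' : SatChain x y)
    (hlex : List.Lex (· < ·) (c.labels (minLabeling G)) (c'.labels (minLabeling G))) :
    ∃ v ∈ c'.support, v ∉ c.support ∧ ∃ c'' : SatChain x y,
      List.Lex (· < ·) (c''.labels (minLabeling G)) (c'.labels (minLabeling G)) ∧
      ∀ u ∈ c'.support, u ≠ v → u ∈ c''.support := by
  induction c' with
  | nil x => simp [SatChain.labels] at hlex
  | @cons x z' y hz' d' ih =>
    cases c with
    | nil => exact absurd (hz'.lt.trans_le d'.le) (lt_irrefl _)
    | @cons _ z _ hz d =>
      simp only [SatChain.labels, List.cons_lex_cons_iff] at hlex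
      rcases hlex with hlt | ⟨heq, hlex⟩
      · obtain ⟨v, hv, hev, c'', hl, hsub⟩ := hmin.exists_descent hz' d'
          (SimpleGraph.edgeSet_mono d.le (label_mem hz)) (label_notMem hz) hlt
        refine ⟨v, List.mem_cons_of_mem _ hv, fun hvc => ?_, c'', hl, fun u hu huv => ?_⟩
        · rcases List.mem_cons.1 hvc with rfl | hvd
          · exact (hz'.lt.trans_le (d'.mem_Icc_of_mem_support hv).1).false
          · exact hev (SimpleGraph.edgeSet_mono (d.mem_Icc_of_mem_support hvd).1 (label_mem hz))
        · rcases List.mem_cons.1 hu with rfl | hu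
          · exact c''.left_mem_support
          · exact hsub u hu huv
      · obtain rfl := hmin.label_injective hz hz' heq
        obtain ⟨v, hv, hvd, c'', hl, hsub⟩ := ih d hlex
        refine ⟨v, List.mem_cons_of_mem _ hv, fun hvc => ?_, .cons hz c'', List.Lex.cons hl,
          fun u hu huv => ?_⟩
        · rcases List.mem_cons.1 hvc with rfl | hvd'
          · exact (hz.lt.trans_le (d'.mem_Icc_of_mem_support hv).1).false
          · exact hvd hvd'
        · rcases List.mem_cons.1 hu with rfl | hu
          · exact SatChain.left_mem_support _
          · exact List.mem_cons_of_mem _ (hsub u hu huv)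

theorem MinEdgeClosed.isShellable (hmin : MinEdgeClosed G) {T : NC G} (hT : IsTop T) :
    IsShellable (orderComplex (NC G)) :=
  isShellable_of_exchange (b := ⊥) hmin.rank_covBy (fun _ => bot_le) hT hmin.label_injective
    hmin.exists_exchange

end NoncrossingBondPoset

/-! ### Noncrossing NBC sets -/

section NCNBC

variable {n : ℕ} {G : SimpleGraph (Fin n)}

theorem reachable_of_forall_adj {V : Type*} {H K : SimpleGraph V}
    (h : ∀ a b, H.Adj a b → K.Reachable a b) {u v : V} (huv : H.Reachable u v) :
    K.Reachable u v := by
  rw [SimpleGraph.reachable_iff_reflTransGen] at huv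
  induction huv with
  | refl => exact SimpleGraph.Reachable.refl _
  | tail _ hab ih => exact ih.trans (h _ _ hab)

theorem image_val_subset {X : SimpleGraph (Fin n)} {S : Finset (Edge G)}
    (h : ∀ e ∈ S, e.val ∈ X.edgeSet) : Edge.val '' (S : Set (Edge G)) ⊆ X.edgeSet := by
  rintro _ ⟨e, he, rfl⟩
  exact h e he

theorem image_val_subset_edgeSet (S : Finset (Edge G)) :
    Edge.val '' (S : Set (Edge G)) ⊆ G.edgeSet := image_val_subset fun e _ => e.mem

variable [LinearOrder (Edge G)]

theorem IsBrokenCircuit.transfer {X Y : SimpleGraph (Fin n)} {x : Fin n} {w : X.Walk x x}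
    (hw : w.IsCycle) {e : Edge G} (he : IsLeast {f : Edge G | f.val ∈ w.edges} e)
    (h : ∀ f ∈ w.edges, f ∈ Y.edgeSet) :
    IsBrokenCircuit Y ({f : Edge G | f.val ∈ w.edges} \ {e}) := by
  refine ⟨x, w.transfer Y h, hw.transfer h, e, ?_⟩
  rw [SimpleGraph.Walk.edges_transfer]
  exact ⟨he, rfl⟩

/-- The noncrossing NBC sets of a noncrossing bond `X` are those of `G` with all edges in `X`. -/
theorem isNCNBC_iff (X : NC G) (S : Finset (Edge G)) :
    IsNCNBC X.1 S ↔ IsNCNBC G S ∧ ∀ e ∈ S, e.val ∈ X.1.edgeSet := by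
  constructor
  · rintro ⟨h1, h2, h3⟩
    refine ⟨⟨fun e _ => e.mem, ?_, h3⟩, h1⟩
    rintro B hB ⟨x, w, hw, e, he, rfl⟩
    have hX : ∀ f ∈ w.edges, f ≠ e.val → f ∈ X.1.edgeSet := fun f hf hne => by
      have hfG := w.edges_subset_edgeSet hf
      exact h1 ⟨f, hfG⟩ (hB ⟨hf, fun h => hne (congrArg Edge.val h)⟩)
    refine h2 _ hB (IsBrokenCircuit.transfer hw he fun f hf => ?_)
    by_cases hfe : f = e.val
    · rw [hfe]
      exact X.2.1.mem_of_cycle le_rfl hw he.1 hX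
    · exact hX f hf hfe
  · rintro ⟨⟨-, h2, h3⟩, h1⟩
    refine ⟨h1, ?_, h3⟩
    rintro B hB ⟨x, w, hw, e, he, rfl⟩
    exact h2 _ hB (IsBrokenCircuit.transfer hw he fun f hf =>
      SimpleGraph.edgeSet_mono X.2.1.1 (w.edges_subset_edgeSet hf))

theorem isSpanningNCNBC_iff (X : NC G) (S : Finset (Edge G)) :
    IsSpanningNCNBC X.1 S ↔
      IsNCNBC G S ∧ inducedBond G (Edge.val '' (S : Set (Edge G))) = X.1 := by
  rw [IsSpanningNCNBC, isNCNBC_iff]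
  constructor
  · rintro ⟨⟨h1, h2⟩, h3⟩
    rw [inducedBond_eq_of_isBond X.2.1 (image_val_subset h2)] at h3
    exact ⟨h1, h3⟩
  · rintro ⟨h1, h2⟩
    have h3 : ∀ e ∈ S, e.val ∈ X.1.edgeSet := fun e he => by
      rw [← h2]
      exact subset_edgeSet_inducedBond (image_val_subset_edgeSet S) ⟨e, he, rfl⟩
    refine ⟨⟨h1, h3⟩, ?_⟩
    rw [inducedBond_eq_of_isBond X.2.1 (image_val_subset h3), h2]

theorem IsNCNBC.mono {X : SimpleGraph (Fin n)} {S S' : Finset (Edge G)} (h : IsNCNBC X S)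
    (hS : S' ⊆ S) : IsNCNBC X S' :=
  ⟨fun e he => h.1 e (hS he), fun B hB => h.2.1 B fun _ hf => hS (hB hf),
    fun e he f hf => h.2.2 e (hS he) f (hS hf)⟩

/-- The noncrossing bond induced on a noncrossing NBC set. -/
def IsNCNBC.bond {S : Finset (Edge G)} (h : IsNCNBC G S) : NC G :=
  ⟨inducedBond G (Edge.val '' (S : Set (Edge G))),
    isBond_inducedBond (image_val_subset_edgeSet S),
    isNoncrossing_inducedBond (image_val_subset_edgeSet S) (by
      rintro _ ⟨e, he, rfl⟩ _ ⟨f, hf, rfl⟩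
      exact h.2.2 e he f hf)⟩

theorem IsNCNBC.isSpanning_bond {S : Finset (Edge G)} (h : IsNCNBC G S) :
    IsSpanningNCNBC h.bond.1 S := (isSpanningNCNBC_iff _ _).2 ⟨h, rfl⟩

/-- An edge below all elements of an NBC set `S` is not spanned by `S`. -/
theorem IsNCNBC.notMem_bond_of_lt {S : Finset (Edge G)} (h : IsNCNBC G S) {e : Edge G}
    (he : ∀ f ∈ S, e < f) :
    e.val ∉ (inducedBond G (Edge.val '' (S : Set (Edge G)))).edgeSet := by
  obtain ⟨⟨u, v⟩, hG⟩ := e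
  intro hmem
  have huv : (SimpleGraph.fromEdgeSet (Edge.val '' (S : Set (Edge G)))).Reachable u v := hmem.2
  have hsub : ∀ f, f ∈ (SimpleGraph.fromEdgeSet (Edge.val '' (S : Set (Edge G)))).edgeSet →
      ∃ g ∈ S, g.val = f := fun f hf => by
    rw [SimpleGraph.edgeSet_fromEdgeSet] at hf
    exact hf.1
  have hnot : s(u, v) ∉ (SimpleGraph.fromEdgeSet (Edge.val '' (S : Set (Edge G)))).edgeSet := by
    intro h'
    obtain ⟨g, hg, hge⟩ := hsub _ h'
    have : g = ⟨s(u, v), hG⟩ := Edge.ext hge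
    exact (he g hg).ne this.symm
  obtain ⟨x, w, hw, hmw, hwS⟩ := exists_cycle_of_reachable
    (fromEdgeSet_le_of_subset (image_val_subset_edgeSet S)) hG hnot huv
  have hwS' : ∀ f : Edge G, f.val ∈ w.edges → f ≠ ⟨s(u, v), hG⟩ → f ∈ S := by
    intro f hf hne
    obtain ⟨g, hg, hgf⟩ := hsub _ (hwS _ hf fun h' => hne (Edge.ext h'))
    rwa [← Edge.ext hgf]
  refine h.2.1 ({f : Edge G | f.val ∈ w.edges} \ {⟨s(u, v), hG⟩})
    (fun f hf => hwS' f hf.1 hf.2) ⟨x, w, hw, ⟨s(u, v), hG⟩, ⟨hmw, fun f hf => ?_⟩, rfl⟩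
  by_cases hfe : f = ⟨s(u, v), hG⟩
  · exact hfe.ge
  · exact (he f (hwS' f hf hfe)).le

/-! ### Decreasing chains and spanning noncrossing NBC sets -/

/-- If all but the smallest edge of a cycle lie in `x` or are labels of a saturated chain that
starts at `x`, then the whole cycle lies in `x`. -/
theorem cycle_subset_of_labels {x y : NC G} (c : SatChain x y) {X : SimpleGraph (Fin n)}
    (hX : X ≤ G) {v : Fin n} {w : X.Walk v v} (hw : w.IsCycle) {e : Edge G}
    (he : IsLeast {f : Edge G | f.val ∈ w.edges} e)
    (h : ∀ f : Edge G, f.val ∈ w.edges → f ≠ e →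
      f.val ∈ x.1.edgeSet ∨ f ∈ c.labels (minLabeling G)) :
    ∀ f : Edge G, f.val ∈ w.edges → f.val ∈ x.1.edgeSet := by
  have hcyc : ∀ (z : NC G) (e : Edge G),
      (∀ f : Edge G, f.val ∈ w.edges → f ≠ e → f.val ∈ z.1.edgeSet) →
      ∀ f : Edge G, f.val ∈ w.edges → f.val ∈ z.1.edgeSet := by
    intro z e hz f hf
    by_cases hfe : f = e
    · subst hfe
      exact z.2.1.mem_of_cycle hX hw hf fun g hg hgf =>
        hz ⟨g, SimpleGraph.edgeSet_mono hX (w.edges_subset_edgeSet hg)⟩ hg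
          fun h => hgf (congrArg Edge.val h)
    · exact hz f hf hfe
  induction c with
  | nil x =>
    refine hcyc x e fun f hf hfe => (h f hf hfe).resolve_right ?_
    simp [SatChain.labels]
  | @cons x z y hxz d ih =>
    have hz := ih fun f hf hfe => by
      rcases h f hf hfe with h' | h'
      · exact Or.inl (SimpleGraph.edgeSet_mono hxz.le h')
      · rcases List.mem_cons.1 h' with rfl | h'
        · exact Or.inl (label_mem hxz)
        · exact Or.inr h'
    -- The cycle already lies in `z`, so no later label is on it; outside `x` only `e` and the label
    -- of `x ⋖ z` remain.
    have hx : ∀ f : Edge G, f.val ∈ w.edges → f ≠ e → f ≠ minLabeling G ⟨(x, z), hxz⟩ →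
        f.val ∈ x.1.edgeSet := by
      intro f hf hfe hfl
      rcases h f hf hfe with h' | h'
      · exact h'
      · exact absurd (hz f hf) (mem_of_mem_labels d ((List.mem_cons.1 h').resolve_left hfl)).2
    by_cases hex : e.val ∈ x.1.edgeSet
    · refine hcyc x (minLabeling G ⟨(x, z), hxz⟩) fun f hf hfl => ?_
      by_cases hfe : f = e
      · rwa [hfe]
      · exact hx f hf hfe hfl
    -- If `e` is new in `z`, the label is at most `e`; were it on the cycle, it would be `e` itself.
    -- So only `e` can be missing from `x`.
    · refine hcyc x e fun f hf hfe => hx f hf hfe ?_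
      rintro rfl
      exact hfe (le_antisymm (label_le hxz (hz e he.1) hex) (he.2 hf))

/-- Along a decreasing chain from `x`, every label `g` is the smallest edge outside of `x` of an
element that contains all labels from `g` upwards. -/
theorem exists_bond_of_isDecreasing {x y : NC G} (c : SatChain x y)
    (hc : c.IsDecreasing (minLabeling G)) {g : Edge G} (hg : g ∈ c.labels (minLabeling G)) :
    ∃ v : NC G, x ≤ v ∧ (∀ f ∈ c.labels (minLabeling G), g ≤ f → f.val ∈ v.1.edgeSet) ∧
      ∀ f : Edge G, f.val ∈ v.1.edgeSet → f.val ∉ x.1.edgeSet → g ≤ f := by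
  induction c with
  | nil x => simp [SatChain.labels] at hg
  | @cons x z y hxz d ih =>
    have hle : ∀ {f}, f ∈ d.labels (minLabeling G) → f ≤ minLabeling G ⟨(x, z), hxz⟩ :=
      List.rel_of_pairwise_cons (List.isChain_iff_pairwise.1 hc)
    rcases List.mem_cons.1 hg with rfl | hgd
    · refine ⟨z, hxz.le, fun f hf hgf => ?_, fun f => label_le hxz⟩
      rcases List.mem_cons.1 hf with rfl | hf
      · exact label_mem hxz
      · rw [le_antisymm (hle hf) hgf]
        exact label_mem hxz
    · obtain ⟨v, hzv, h1, h2⟩ := ih (List.isChain_cons.1 hc).2 hgd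
      refine ⟨v, hxz.le.trans hzv, fun f hf hgf => ?_, fun f hf hfx => ?_⟩
      · rcases List.mem_cons.1 hf with rfl | hf
        · exact SimpleGraph.edgeSet_mono hzv (label_mem hxz)
        · exact h1 f hf hgf
      · by_cases hfz : f.val ∈ z.1.edgeSet
        · exact (hle hgd).trans (label_le hxz hfz hfx)
        · exact h2 f hf hfz

/-- Each step adds only the connections made by its label, so the labels together with `x` generate
all connectivity of `y`. -/
theorem MinEdgeClosed.reachable_of_labels (hmin : MinEdgeClosed G) {x y : NC G}
    (c : SatChain x y) {u v : Fin n} (h : y.1.Reachable u v) :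
    (SimpleGraph.fromEdgeSet
      (x.1.edgeSet ∪ Edge.val '' {e | e ∈ c.labels (minLabeling G)})).Reachable u v := by
  induction c with
  | nil x => exact h.mono (le_fromEdgeSet_of_subset Set.subset_union_left)
  | @cons x z y hxz d ih =>
    refine reachable_of_forall_adj (fun a b hab => ?_) (ih h)
    rw [SimpleGraph.fromEdgeSet_adj] at hab
    rcases hab with ⟨hab | ⟨e, he, heab⟩, hne⟩
    · have hab : z.1.Adj a b := hab
      rw [hmin.eq_insert_of_covBy hxz] at hab
      refine hab.2.mono (SimpleGraph.fromEdgeSet_mono (Set.union_subset_union_right _ ?_))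
      rintro _ rfl
      exact ⟨_, List.mem_cons_self, rfl⟩
    · refine SimpleGraph.Adj.reachable ?_
      rw [SimpleGraph.fromEdgeSet_adj]
      exact ⟨Or.inr ⟨e, List.mem_cons_of_mem _ he, heab⟩, hne⟩

theorem MinEdgeClosed.isSpanningNCNBC_labels (hmin : MinEdgeClosed G) {X : NC G}
    (c : SatChain ⊥ X) (hc : c.IsDecreasing (minLabeling G)) :
    IsSpanningNCNBC X.1 (c.labels (minLabeling G)).toFinset := by
  have hbot : ∀ f : Edge G, f.val ∉ (⊥ : NC G).1.edgeSet := fun f h => by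
    have : f.val ∈ (⊥ : SimpleGraph (Fin n)).edgeSet := h
    simp at this
  refine ⟨⟨fun e he => (mem_of_mem_labels c (List.mem_toFinset.1 he)).1, ?_, ?_⟩, ?_⟩
  · rintro B hB ⟨v, w, hw, e, he, rfl⟩
    refine hbot e (cycle_subset_of_labels c X.2.1.1 hw he (fun f hf hfe => Or.inr ?_) e he.1)
    exact List.mem_toFinset.1 (hB ⟨hf, hfe⟩)
  · have key : ∀ e ∈ c.labels (minLabeling G), ∀ f ∈ c.labels (minLabeling G), e ≤ f →
        ¬ EdgesCross e.val f.val := by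
      intro e he f hf hef
      obtain ⟨v, -, h1, h2⟩ := exists_bond_of_isDecreasing c hc he
      exact hmin.not_edgesCross (h1 e he le_rfl) (h1 f hf hef) fun g hg => h2 g hg (hbot g)
    intro e he f hf
    rw [List.mem_toFinset] at he hf
    rcases le_total e f with h | h
    · exact key e he f hf h
    · exact fun h' => key f hf e he h h'.symm
  · ext u v
    refine ⟨fun h => h.1, fun h => ⟨h, ?_⟩⟩
    refine (hmin.reachable_of_labels c h.reachable).mono (SimpleGraph.fromEdgeSet_mono ?_)
    refine Set.union_subset (fun e he => ?_) ?_
    · have : e ∈ (⊥ : SimpleGraph (Fin n)).edgeSet := he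
      simp at this
    · rintro _ ⟨e, he, rfl⟩
      exact ⟨e, List.mem_toFinset.2 he, rfl⟩

/-- The least edge `a` must be the last label: a chain for the bond of the other edges is extended
by one cover, whose label is the new edge. -/
theorem exists_isDecreasing_of_isNCNBC (S : Finset (Edge G)) (hS : IsNCNBC G S) (X : NC G)
    (hX : inducedBond G (Edge.val '' (S : Set (Edge G))) = X.1) :
    ∃ c : SatChain ⊥ X, c.IsDecreasing (minLabeling G) ∧
      (c.labels (minLabeling G)).toFinset = S := by
  induction S using Finset.induction_on_min generalizing X with
  | empty =>
    obtain rfl : ⊥ = X := by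
      apply Subtype.ext
      rw [← hX]
      ext u v
      change False ↔ _
      simp only [false_iff]
      rintro ⟨h, h'⟩
      simp only [Finset.coe_empty, Set.image_empty, SimpleGraph.fromEdgeSet_empty,
        SimpleGraph.reachable_bot] at h'
      exact h.ne h'
    exact ⟨.nil ⊥, List.IsChain.nil, rfl⟩
  | insert a s ha ih =>
    have hs := hS.mono (Finset.subset_insert a s)
    obtain ⟨c, hc, hcs⟩ := ih hs hs.bond rfl
    have haX' : a.val ∉ hs.bond.1.edgeSet := hs.notMem_bond_of_lt ha
    have hSX : ∀ e ∈ insert a s, e.val ∈ X.1.edgeSet := fun e he => by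
      rw [← hX]
      exact subset_edgeSet_inducedBond (image_val_subset_edgeSet _) ⟨e, he, rfl⟩
    have hle : hs.bond.1 ≤ X.1 := inducedBond_le_of_subset X.2.1
      (image_val_subset fun e he => hSX e (Finset.mem_insert_of_mem he))
    have hU := union_edge_subset hs.bond a
    have hXeq : X.1 = inducedBond G (hs.bond.1.edgeSet ∪ {a.val}) := by
      refine le_antisymm ?_ ?_
      · rw [← hX]
        refine inducedBond_le_of_subset (isBond_inducedBond hU) (image_val_subset fun e he => ?_)
        refine subset_edgeSet_inducedBond hU ?_
        rcases Finset.mem_insert.1 he with rfl | he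
        · exact Or.inr rfl
        · exact Or.inl (subset_edgeSet_inducedBond (image_val_subset_edgeSet _) ⟨e, he, rfl⟩)
      · exact inducedBond_le_of_subset X.2.1 (Set.union_subset (SimpleGraph.edgeSet_mono hle)
          (Set.singleton_subset_iff.2 (hSX a (Finset.mem_insert_self a s))))
    have hcov : hs.bond ⋖ X := covBy_of_eq_insert haX' hXeq
    have hlab : minLabeling G ⟨(hs.bond, X), hcov⟩ = a := by
      refine le_antisymm (label_le hcov (hSX a (Finset.mem_insert_self a s)) haX') ?_
      by_contra hlt
      rw [not_le] at hlt
      -- A label below `a` would lie in the bond of the NBC set while being smaller than all its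
      -- elements.
      refine hS.notMem_bond_of_lt (e := minLabeling G ⟨(hs.bond, X), hcov⟩) (fun f hf => ?_) ?_
      · rcases Finset.mem_insert.1 hf with rfl | hf
        · exact hlt
        · exact hlt.trans (ha f hf)
      · rw [hX]
        exact label_mem hcov
    have hlabs : (c.append (.cons hcov (.nil X))).labels (minLabeling G) =
        c.labels (minLabeling G) ++ [a] := by
      rw [SatChain.labels_append, SatChain.labels, SatChain.labels, hlab]
    refine ⟨c.append (.cons hcov (.nil X)), ?_, ?_⟩
    · rw [SatChain.IsDecreasing, hlabs, List.isChain_iff_pairwise, List.pairwise_append]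
      refine ⟨List.isChain_iff_pairwise.1 hc, List.pairwise_singleton _ _, fun f hf b hb => ?_⟩
      rw [List.mem_singleton.1 hb]
      refine (ha f ?_).le
      rw [← hcs]
      exact List.mem_toFinset.2 hf
    · rw [hlabs, List.toFinset_append, hcs]
      ext e
      simp

/-- A set without repetitions has only one decreasing listing, and the label sequence determines the
chain. -/
theorem MinEdgeClosed.existsUnique_isDecreasing (hmin : MinEdgeClosed G) (X : NC G)
    (S : Finset (Edge G)) (hS : IsSpanningNCNBC X.1 S) :
    ∃! c : SatChain ⊥ X, c.IsDecreasing (minLabeling G) ∧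
      (c.labels (minLabeling G)).toFinset = S := by
  obtain ⟨h1, h2⟩ := (isSpanningNCNBC_iff X S).1 hS
  obtain ⟨c, hc, hcS⟩ := exists_isDecreasing_of_isNCNBC S h1 X h2
  refine ⟨c, ⟨hc, hcS⟩, ?_⟩
  rintro c' ⟨hc', hcS'⟩
  refine SatChain.ext_labels (lam := minLabeling G) hmin.label_injective c' c ?_
  have hperm := List.perm_of_nodup_nodup_toFinset_eq (nodup_labels c') (nodup_labels c)
    (hcS'.trans hcS.symm)
  exact hperm.eq_of_pairwise' (List.isChain_iff_pairwise.1 hc') (List.isChain_iff_pairwise.1 hc)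

theorem MinEdgeClosed.card_eq_rank (hmin : MinEdgeClosed G) {X : NC G} {S : Finset (Edge G)}
    (hS : IsSpanningNCNBC X.1 S) : S.card = n - cc X.1 := by
  obtain ⟨h1, h2⟩ := (isSpanningNCNBC_iff X S).1 hS
  obtain ⟨c, -, rfl⟩ := exists_isDecreasing_of_isNCNBC S h1 X h2
  rw [List.toFinset_card_of_nodup (nodup_labels c), SatChain.length_labels]
  have h3 := c.add_length hmin.rank_covBy
  have h4 : cc (⊥ : NC G).1 = n := cc_bot
  omega

/-- The spanning noncrossing NBC sets are those of maximal size. -/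
theorem MinEdgeClosed.isSpanningNCNBC_iff_card (hmin : MinEdgeClosed G) (X : NC G)
    (S : Finset (Edge G)) :
    IsSpanningNCNBC X.1 S ↔ IsNCNBC X.1 S ∧ S.card = n - cc X.1 := by
  refine ⟨fun h => ⟨h.1, hmin.card_eq_rank h⟩, fun ⟨h, hcard⟩ => ?_⟩
  obtain ⟨hG, hsub⟩ := (isNCNBC_iff X S).1 h
  have hle : hG.bond ≤ X := inducedBond_le_of_subset X.2.1 (image_val_subset hsub)
  have h1 := hmin.card_eq_rank hG.isSpanning_bond
  suffices hG.bond = X by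
    have h2 := hG.isSpanning_bond
    rwa [this] at h2
  -- The bond of `S` and `X` have equal rank, so a saturated chain between them has no steps.
  obtain ⟨c⟩ := SatChain.nonempty hle
  have h2 := c.add_length hmin.rank_covBy
  cases hc : c with
  | nil => rfl
  | cons h d =>
    rw [hc, SatChain.length] at h2
    omega

end NCNBC

/-! ### The Möbius function and the characteristic polynomial -/

section Mobius

variable {n : ℕ} {G : SimpleGraph (Fin n)} [LinearOrder (Edge G)]

/-- The smallest edge of a noncrossing bond `X` can be added to any noncrossing NBC set of `X`. -/
theorem MinEdgeClosed.isNCNBC_insert (hmin : MinEdgeClosed G) {X : NC G} {e : Edge G}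
    (he : e.val ∈ X.1.edgeSet) (hle : ∀ f : Edge G, f.val ∈ X.1.edgeSet → e ≤ f)
    {S : Finset (Edge G)} (hS : IsNCNBC X.1 S) : IsNCNBC X.1 (insert e S) := by
  have hmem : ∀ f ∈ insert e S, f.val ∈ X.1.edgeSet := fun f hf => by
    rcases Finset.mem_insert.1 hf with rfl | hf
    exacts [he, hS.1 f hf]
  have hcross : ∀ f ∈ insert e S, ¬ EdgesCross e.val f.val := fun f hf =>
    hmin.not_edgesCross he (hmem f hf) hle
  refine ⟨hmem, ?_, ?_⟩
  · rintro B hB ⟨v, w, hw, m, hm, rfl⟩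
    refine hS.2.1 _ (fun f hf => ?_) ⟨v, w, hw, m, hm, rfl⟩
    -- The least edge of `X` lies in no broken circuit: on a cycle it is the edge that gets removed.
    refine (Finset.mem_insert.1 (hB hf)).resolve_left ?_
    rintro rfl
    exact hf.2 (le_antisymm (hle m (w.edges_subset_edgeSet hm.1)) (hm.2 hf.1))
  · intro f hf g hg
    rcases Finset.mem_insert.1 hf with rfl | hf'
    · exact hcross g hg
    · rcases Finset.mem_insert.1 hg with rfl | hg'
      · exact fun h => hcross f hf h.symm
      · exact hS.2.2 f hf' g hg'

theorem exists_least_edge {X : NC G} (hX : X ≠ ⊥) :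
    ∃ e : Edge G, e.val ∈ X.1.edgeSet ∧ ∀ f : Edge G, f.val ∈ X.1.edgeSet → e ≤ f := by
  have hlt : ⊥ < X := bot_lt_iff_ne_bot.2 hX
  refine ⟨minEdge hlt, (minEdge_mem hlt).1, fun f hf => minEdge_le hlt hf fun h => ?_⟩
  have : f.val ∈ (⊥ : SimpleGraph (Fin n)).edgeSet := h
  simp at this

open Classical in
theorem MinEdgeClosed.sum_isNCNBC_eq_zero [Fintype (Edge G)] (hmin : MinEdgeClosed G) {X : NC G}
    (hX : X ≠ ⊥) :
    ∑ S : Finset (Edge G) with IsNCNBC X.1 S, (-1 : ℤ) ^ S.card = 0 := by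
  obtain ⟨e, he, hle⟩ := exists_least_edge hX
  -- Toggling the least edge of `X` changes the parity and keeps the set noncrossing and NBC.
  refine Finset.sum_involution (fun S _ => if e ∈ S then S.erase e else insert e S) ?_ ?_ ?_ ?_
  · intro S _
    by_cases h : e ∈ S
    · rw [if_pos h, ← Finset.card_erase_add_one h, pow_succ]
      ring
    · rw [if_neg h, Finset.card_insert_of_notMem h, pow_succ]
      ring
  · intro S _ _ h'
    by_cases h : e ∈ S
    · rw [if_pos h] at h'
      exact Finset.notMem_erase e S (h'.symm ▸ h)
    · rw [if_neg h] at h'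
      exact h (h' ▸ Finset.mem_insert_self e S)
  · intro S hS
    have hS := (Finset.mem_filter.1 hS).2
    refine Finset.mem_filter.2 ⟨Finset.mem_univ _, ?_⟩
    split_ifs
    · exact hS.mono (Finset.erase_subset e S)
    · exact hmin.isNCNBC_insert he hle hS
  · intro S _
    by_cases h : e ∈ S
    · simp [h]
    · simp [h]

open Classical in
theorem ncnbc_eq_card [Fintype (Edge G)] (X : SimpleGraph (Fin n)) (k : ℕ) :
    ncnbc G X k = (Finset.univ.filter fun S : Finset (Edge G) =>
      IsNCNBC X S ∧ S.card = k).card := by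
  rw [ncnbc, ← Set.ncard_coe_finset]
  congr 1
  ext S
  simp

open Classical in
/-- Sums over the noncrossing NBC sets of `X`, sorted by the bonds that they induce. -/
theorem MinEdgeClosed.sum_isNCNBC [Fintype (Edge G)] [Fintype (NC G)] (hmin : MinEdgeClosed G)
    {M : Type*} [AddCommMonoid M] (X : NC G) (g : ℕ → M) :
    ∑ S : Finset (Edge G) with IsNCNBC X.1 S, g S.card =
      ∑ Y : NC G with Y ≤ X, ncnbc G Y.1 (n - cc Y.1) • g (n - cc Y.1) := by
  let b : Finset (Edge G) → NC G := fun S => if h : IsNCNBC G S then h.bond else ⊥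
  have hb : ∀ {S} (h : IsNCNBC G S), b S = h.bond := fun h => dif_pos h
  rw [← Finset.sum_fiberwise_of_maps_to (g := b) (t := Finset.univ.filter (· ≤ X))]
  · refine Finset.sum_congr rfl fun Y hY => ?_
    have hYX : Y ≤ X := (Finset.mem_filter.1 hY).2
    have hset : (Finset.univ.filter fun S : Finset (Edge G) => IsNCNBC X.1 S).filter (b · = Y) =
        Finset.univ.filter fun S : Finset (Edge G) => IsNCNBC Y.1 S ∧ S.card = n - cc Y.1 := by
      ext S
      simp only [Finset.mem_filter, Finset.mem_univ, true_and]
      rw [← hmin.isSpanningNCNBC_iff_card]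
      constructor
      · rintro ⟨h, rfl⟩
        have hG := ((isNCNBC_iff X S).1 h).1
        rw [hb hG]
        exact hG.isSpanning_bond
      · intro h
        obtain ⟨hG, hY⟩ := (isNCNBC_iff Y S).1 h.1
        refine ⟨(isNCNBC_iff X S).2 ⟨hG, fun e he => SimpleGraph.edgeSet_mono hYX (hY e he)⟩, ?_⟩
        rw [hb hG]
        exact Subtype.ext ((isSpanningNCNBC_iff Y S).1 h).2
    rw [hset, ncnbc_eq_card, ← Finset.sum_const]
    exact Finset.sum_congr rfl fun S hS => by rw [(Finset.mem_filter.1 hS).2.2]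
  · intro S hS
    obtain ⟨hG, hX⟩ := (isNCNBC_iff X S).1 (Finset.mem_filter.1 hS).2
    rw [hb hG]
    exact Finset.mem_filter.2 ⟨Finset.mem_univ _,
      inducedBond_le_of_subset X.2.1 (image_val_subset hX)⟩

theorem ncnbc_bot : ncnbc G ⊥ 0 = 1 := by
  rw [ncnbc, Set.ncard_eq_one]
  refine ⟨∅, Set.eq_singleton_iff_unique_mem.2 ⟨⟨⟨by simp, ?_, by simp⟩, rfl⟩, fun S hS =>
    Finset.card_eq_zero.1 hS.2⟩⟩
  rintro B - ⟨v, w, -, e, he, -⟩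
  have := w.edges_subset_edgeSet he.1
  simp at this

/-- For `H ≠ ⊥` the signed count of noncrossing NBC sets vanishes; grouped by induced bond it is a
sum over `Y ≤ H`, so the right side obeys the Möbius recursion. -/
theorem MinEdgeClosed.mobius_eq_ncnbc (hmin : MinEdgeClosed G) (H : NC G) :
    mobius H = (-1) ^ (n - cc H.1) * (ncnbc G H.1 (n - cc H.1) : ℤ) := by
  classical
  let _ := Fintype.ofFinite (Edge G)
  let _ := Fintype.ofFinite (NC G)
  induction H using (Finite.to_wellFoundedLT (α := NC G)).wf.induction with
  | _ H ih =>
  rw [mobius_eq]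
  by_cases hH : H = ⊥
  · have h1 : H.1 = ⊥ := congrArg Subtype.val hH
    rw [if_pos hH, h1, cc_bot, Nat.sub_self, ncnbc_bot]
    simp
  · have h1 := hmin.sum_isNCNBC H fun k => (-1 : ℤ) ^ k
    rw [hmin.sum_isNCNBC_eq_zero hH] at h1
    have h2 : (Finset.univ.filter (· ≤ H)) = insert H (Finset.univ.filter (· < H)) := by
      ext Y
      simp [le_iff_eq_or_lt]
    rw [h2, Finset.sum_insert (by simp)] at h1
    rw [if_neg hH, Finset.sum_congr rfl fun Y hY => ih Y (by simpa using hY)]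
    simp only [nsmul_eq_mul] at h1
    rw [neg_eq_iff_add_eq_zero, add_comm, h1]
    congr 1
    · ring
    · exact Finset.sum_congr rfl fun Y _ => mul_comm _ _

theorem rank_le_posetRank {P : Type*} [PartialOrder P] [Finite P] (x : P) :
    rank x ≤ posetRank P := by
  let _ := Fintype.ofFinite P
  exact Finset.le_sup (f := (rank : P → ℕ)) (Finset.mem_univ x)

theorem MinEdgeClosed.card_le_posetRank (hmin : MinEdgeClosed G) {S : Finset (Edge G)}
    (hS : IsNCNBC G S) : S.card ≤ posetRank (NC G) := by
  rw [hmin.card_eq_rank hS.isSpanning_bond, ← hmin.rank_eq]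
  exact rank_le_posetRank _

/-- The maximum is `G`, so the sum over all bonds is a sum over all noncrossing NBC sets of `G`,
with exponents depending only on their size. -/
theorem MinEdgeClosed.charPoly_eq (hmin : MinEdgeClosed G) {T : NC G} (hT : IsTop T) :
    charPoly (NC G) = ∑ k ∈ Finset.range (posetRank (NC G) + 1),
      Polynomial.C ((-1) ^ k * (ncnbc G G k : ℤ)) * Polynomial.X ^ (posetRank (NC G) - k) := by
  classical
  let _ := Fintype.ofFinite (Edge G)
  let _ := Fintype.ofFinite (NC G)
  let g : ℕ → Polynomial ℤ := fun k =>
    Polynomial.C ((-1) ^ k) * Polynomial.X ^ (posetRank (NC G) - k)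
  have hC : ∀ m : ℕ, Polynomial.C (m : ℤ) = (m : Polynomial ℤ) := fun m => by simp
  have h1 : charPoly (NC G) = ∑ Y : NC G, ncnbc G Y.1 (n - cc Y.1) • g (n - cc Y.1) := by
    refine Finset.sum_congr rfl fun Y _ => ?_
    rw [hmin.mobius_eq_ncnbc, hmin.rank_eq, nsmul_eq_mul, Polynomial.C_mul, hC]
    ring
  have h2 := hmin.sum_isNCNBC T g
  rw [Finset.filter_true_of_mem fun Y _ => hT Y, eq_of_isTop hT] at h2
  rw [h1, ← h2, ← Finset.sum_fiberwise_of_maps_to (g := Finset.card)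
    (t := Finset.range (posetRank (NC G) + 1))]
  · refine Finset.sum_congr rfl fun k _ => ?_
    rw [Finset.filter_filter, ncnbc_eq_card,
      Finset.sum_congr rfl (g := fun _ => g k) fun S hS => by rw [(Finset.mem_filter.1 hS).2.2],
      Finset.sum_const, nsmul_eq_mul, Polynomial.C_mul, hC]
    ring
  · intro S hS
    exact Finset.mem_range_succ_iff.2 (hmin.card_le_posetRank (Finset.mem_filter.1 hS).2)

end Mobius

end NoncrossingBond

end

open NoncrossingBond in
theorem theorem4p4 {n : ℕ} (G : SimpleGraph (Fin n)) [LinearOrder (Edge G)]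
    (htop : ∃ T : NC G, IsTop T)
    (hmin : ∀ (H H' : NC G) (h : H < H'),
      IsNoncrossing (inducedBond G (H.1.edgeSet ∪ {(minEdge h).val}))) :
    -- (a)
    (IsGraded (NC G) ∧ ∀ X : NC G, rank X = n - cc X.1) ∧
    -- (b)
    (IsELLabeling (minLabeling G) ∧ IsShellable (orderComplex (NC G))) ∧
    -- (c)
    (∀ (X : NC G) (c : SatChain ⊥ X), c.IsDecreasing (minLabeling G) →
      IsSpanningNCNBC X.1 (c.labels (minLabeling G)).toFinset) ∧
    -- (d)
    (∀ (X : NC G) (S : Finset (Edge G)), IsSpanningNCNBC X.1 S →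
      ∃! c : SatChain ⊥ X, c.IsDecreasing (minLabeling G) ∧
        (c.labels (minLabeling G)).toFinset = S) ∧
    -- (e)
    (∀ H : NC G, mobius H = (-1) ^ (n - cc H.1) * (ncnbc G H.1 (n - cc H.1) : ℤ)) ∧
    (∀ k, posetRank (NC G) < k → ncnbc G G k = 0) ∧
    charPoly (NC G) = ∑ k ∈ Finset.range (posetRank (NC G) + 1),
      Polynomial.C ((-1) ^ k * (ncnbc G G k : ℤ)) * Polynomial.X ^ (posetRank (NC G) - k) := by
  have hclosed : MinEdgeClosed G := hmin
  obtain ⟨T, hT⟩ := htop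
  refine ⟨⟨?_, hclosed.rank_eq⟩, ⟨hclosed.isELLabeling, hclosed.isShellable hT⟩,
    fun X c hc => hclosed.isSpanningNCNBC_labels c hc, hclosed.existsUnique_isDecreasing,
    hclosed.mobius_eq_ncnbc, fun k hk => ?_, hclosed.charPoly_eq hT⟩
  · exact isGraded_of_covBy (b := ⊥) hclosed.rank_covBy (fun _ => bot_le) hT
  · rw [ncnbc, Set.ncard_eq_zero]
    refine Set.eq_empty_of_forall_notMem fun S hS => ?_
    have := hclosed.card_le_posetRank hS.1
    have := hS.2
    omega
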